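/- For a real number $x$ let $\|x\|=\min_{n\in\mathbb Z}|x-n|$. The type of an irrational number $\gamma$ is $$\tau=\sup\Bigl\{\varrho\in\mathbb R:\liminf_{n\to\infty,\ n\in\mathbb N}n^{\varrho}\,\|\gamma n\|=0\Bigr\},$$ and $\gamma$ is of finite type if $\tau<\infty$. Let $\Lambda$ be the von Mangoldt function, extended by $\Lambda(m)=0$ to integers $m\le 0$. **Theorem.** Let $\alpha$ be a positive irrational real number of finite type. Then there is a constant $\kappa>0$, depending only on $\alpha$, such that for every real number $\beta$ the following holds: for all integers $N\ge 1$ and all integers $a,q$ with $0\le a<q\le N^{\kappa}$ and $\gcd(a,q)=1$, we have $$\sum_{\substack{1\le n\le N\\ \lfloor\alpha n+\beta\rfloor\equiv a\ (\mathrm{mod}\ q)}}\Lambda(\lfloor\alpha n+\beta\rfloor)=\alpha^{-1}\sum_{\substack{1\le m\le\lfloor\alpha N+\beta\rfloor\\ m\equiv a\ (\mathrm{mod}\ q)}}\Lambda(m)+O\bigl(N^{1-\kappa}\bigr),$$ where the implied constant depends only on $\alpha$ and $\beta$. -/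

import Mathlib

/-- The distance `‖x‖` from the real number `x` to the nearest integer. -/
noncomputable def distNearestInt (x : ℝ) : ℝ := |x - (round x : ℝ)|

/-- `distNearestInt x` is the minimum of `|x - n|` over all integers `n`. -/
theorem distNearestInt_isLeast (x : ℝ) :
    IsLeast (Set.range fun n : ℤ => |x - (n : ℝ)|) (distNearestInt x) := by
  refine ⟨⟨round x, rfl⟩, ?_⟩
  rintro _ ⟨n, rfl⟩
  exact round_le x n

/-- The type `τ = sup {ρ ∈ ℝ : liminf_{n → ∞} n ^ ρ * ‖γ n‖ = 0}` of a real number `γ`, as an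
extended real number.  The lower limit is taken in `[0, ∞]`, so that it has its usual value
when `n ^ ρ * ‖γ n‖` is unbounded. -/
noncomputable def diophantineType (γ : ℝ) : EReal :=
  sSup ((fun ρ : ℝ => (ρ : EReal)) '' {ρ : ℝ |
    Filter.liminf (fun n : ℕ => ENNReal.ofReal ((n : ℝ) ^ ρ * distNearestInt (γ * n)))
      Filter.atTop = 0})

/-- `γ` is of finite type. -/
def IsOfFiniteType (γ : ℝ) : Prop := diophantineType γ < ⊤

/-- The von Mangoldt function on the integers; it vanishes at integers `m ≤ 0`, which are not
powers of a prime. -/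
noncomputable def vonMangoldtInt (m : ℤ) : ℝ := ArithmeticFunction.vonMangoldt m.toNat

/-- The sum of `Λ(⌊α n + β⌋)` over `1 ≤ n ≤ N` with `⌊α n + β⌋ ≡ a (mod q)`. -/
noncomputable def beattySum (α β : ℝ) (a q N : ℕ) : ℝ :=
  ∑ n ∈ (Finset.Icc 1 N).filter (fun n : ℕ => ⌊α * n + β⌋ ≡ (a : ℤ) [ZMOD (q : ℤ)]),
    vonMangoldtInt ⌊α * n + β⌋

/-- The sum of `Λ(m)` over `1 ≤ m ≤ M` with `m ≡ a (mod q)`; it is empty if `M ≤ 0`. -/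
noncomputable def progressionSum (a q : ℕ) (M : ℤ) : ℝ :=
  ∑ m ∈ (Finset.Icc 1 M).filter (fun m : ℤ => m ≡ (a : ℤ) [ZMOD (q : ℤ)]), vonMangoldtInt m

/-!
Write `γ = α⁻¹`, `e(x) = exp(2πix)`, `‖x‖` for the distance to the nearest integer and `{x}` for
the fractional part. For an integer `m` there are exactly `γ + {γ(β - 1 - m)} - {γ(β - m)}`
integers `n` with `⌊αn + β⌋ = m`. Hence, up to boundary terms, the difference of the two sides is
a difference of two sums of `Λ(m) ({y - mγ} - 1/2)` over `m ≡ a (mod q)` (`abs_beattySum_sub_le`),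
and it suffices to save a power of `N` in these.

The sawtooth `{x} - 1/2` is replaced by a trigonometric polynomial, the truncated Fourier series
of its mean over an interval of length `Δ`, which is a difference quotient of the second Bernoulli
function. The approximation fails only if `x` is within `Δ` of an integer. Finite type passes from
`α` to `γ` and means `‖hγ‖ ≥ c h ^ (-A)`, so that the exceptional `m` are spaced and few
(`abs_sum_mul_fract_sub_half_le`).

What remains are the sums of `Λ(m) e(kmγ)` over `m ≡ a (mod q)`. They are averages over `b` of the
full sums of `Λ(m) e(mθ)` with `θ = kγ + b/q` (`norm_sum_modEq_mul_addChar_le`), and each such `θ`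
still satisfies `‖hθ‖ ≥ c / (q (qhk) ^ A)`, with a loss that is a power of the small numbers `k`
and `q`. Therefore Vinogradov's method applies directly in terms of lower bounds for `‖hθ‖`, with
no rational approximation to `θ`. By Vaughan's identity (`vaughan_identity`) the sum splits into
a short sum, double sums with a short first variable, in which the inner geometric sum cancels
(`norm_linear_sum_le`), and a bilinear sum in which both variables are long. The latter is
estimated by Cauchy's inequality, because the `n` for which `‖(n₁ - n)θ‖` is small are again
spaced (`norm_bilinear_sum_sq_le`). Up to constants, all parameters are powers of one integer `P`,
which is about a small power of `N`.
-/

/-! ### Distance to the nearest integer -/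

theorem distNearestInt_eq_norm (x : ℝ) : distNearestInt x = ‖(x : UnitAddCircle)‖ :=
  UnitAddCircle.norm_eq.symm

theorem distNearestInt_nonneg (x : ℝ) : 0 ≤ distNearestInt x := abs_nonneg _

theorem distNearestInt_le_abs_sub (x : ℝ) (n : ℤ) : distNearestInt x ≤ |x - n| := round_le x n

theorem distNearestInt_neg (x : ℝ) : distNearestInt (-x) = distNearestInt x := by
  simp [distNearestInt_eq_norm]

theorem distNearestInt_add_int (x : ℝ) (n : ℤ) : distNearestInt (x + n) = distNearestInt x := by
  simp [distNearestInt]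

theorem distNearestInt_sub_le (x y : ℝ) :
    distNearestInt (x - y) ≤ distNearestInt x + distNearestInt y := by
  simp only [distNearestInt_eq_norm, AddCircle.coe_sub]
  exact norm_sub_le _ _

theorem distNearestInt_nat_mul_le (n : ℕ) (x : ℝ) :
    distNearestInt (n * x) ≤ n * distNearestInt x := by
  have := norm_nsmul_le (n := n) (a := (x : UnitAddCircle))
  rw [← AddCircle.coe_nsmul, nsmul_eq_mul] at this
  simpa [distNearestInt_eq_norm] using this

theorem distNearestInt_pos_of_irrational {x : ℝ} (hx : Irrational x) : 0 < distNearestInt x := by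
  have := hx.ne_int (round x)
  exact abs_pos.mpr (sub_ne_zero.mpr this)

/-- A number of finite type is not too well approximable by rationals: `‖γ n‖` is bounded below by
a power of `n`. -/
theorem exists_le_distNearestInt_of_isOfFiniteType {γ : ℝ} (hirr : Irrational γ)
    (h : IsOfFiniteType γ) :
    ∃ A : ℕ, ∃ c : ℝ, 0 < c ∧ ∀ n : ℕ, 1 ≤ n → c ≤ (n : ℝ) ^ A * distNearestInt (γ * n) := by
  obtain ⟨r, hr, -⟩ := EReal.lt_iff_exists_real_btwn.mp h
  obtain ⟨A, hA⟩ := exists_nat_gt r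
  have hnot : Filter.liminf (fun n : ℕ =>
      ENNReal.ofReal ((n : ℝ) ^ (A : ℝ) * distNearestInt (γ * n))) Filter.atTop ≠ 0 := by
    intro h0
    have : ((A : ℝ) : EReal) ≤ diophantineType γ := le_sSup ⟨(A : ℝ), h0, rfl⟩
    exact absurd (this.trans_lt hr) (not_lt.mpr (by exact_mod_cast hA.le))
  obtain ⟨ε, hε, hlt⟩ := exists_between (pos_iff_ne_zero.mpr hnot)
  have hev := Filter.eventually_lt_of_lt_liminf hlt
  obtain ⟨n₀, hn₀⟩ := Filter.eventually_atTop.mp hev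
  have hεtop : ε ≠ ⊤ := ne_top_of_lt (hn₀ n₀ le_rfl)
  have hpos : ∀ n : ℕ, 1 ≤ n → 0 < (n : ℝ) ^ A * distNearestInt (γ * n) := fun n hn => by
    have h1 : 0 < distNearestInt (γ * n) :=
      distNearestInt_pos_of_irrational (hirr.mul_natCast (by omega))
    positivity
  -- finitely many `n` lie below the threshold, and there the product is positive
  have hfin : ∀ m : ℕ, ∃ c : ℝ, 0 < c ∧
      ∀ n : ℕ, 1 ≤ n → n < m → c ≤ (n : ℝ) ^ A * distNearestInt (γ * n) := by
    intro m
    induction m with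
    | zero => exact ⟨1, one_pos, fun n _ hn => absurd hn (Nat.not_lt_zero n)⟩
    | succ m ih =>
      obtain ⟨c, hc, h⟩ := ih
      rcases Nat.eq_zero_or_pos m with rfl | hm
      · exact ⟨1, one_pos, fun n h1 hn => by omega⟩
      · refine ⟨min c ((m : ℝ) ^ A * distNearestInt (γ * m)), lt_min hc (hpos m hm), ?_⟩
        intro n h1 hn
        rcases Nat.lt_succ_iff_lt_or_eq.mp hn with h2 | rfl
        · exact (min_le_left _ _).trans (h n h1 h2)
        · exact min_le_right _ _
  obtain ⟨c, hc, hcle⟩ := hfin n₀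
  refine ⟨A, min c ε.toReal, lt_min hc (ENNReal.toReal_pos hε.ne' hεtop), fun n hn => ?_⟩
  rcases lt_or_ge n n₀ with h1 | h1
  · exact (min_le_left _ _).trans (hcle n hn h1)
  · refine (min_le_right _ _).trans ?_
    have h2 := (hn₀ n h1).le
    rw [Real.rpow_natCast] at h2
    exact ENNReal.toReal_le_of_le_ofReal (hpos n hn).le h2

/-- Being badly approximable up to a power passes to the inverse: an approximation `m / n` of `γ⁻¹`
gives the approximation `n / m` of `γ`. -/
theorem exists_le_distNearestInt_inv {γ : ℝ} (hγ : 0 < γ) {A : ℕ} {c : ℝ} (hc : 0 < c)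
    (h : ∀ n : ℕ, 1 ≤ n → c ≤ (n : ℝ) ^ A * distNearestInt (γ * n)) :
    ∃ c' : ℝ, 0 < c' ∧ ∀ n : ℕ, 1 ≤ n → c' ≤ (n : ℝ) ^ A * distNearestInt (γ⁻¹ * n) := by
  have hγ' : 0 < γ⁻¹ := inv_pos.mpr hγ
  have hK : 0 < (γ⁻¹ + 1) ^ A := by positivity
  refine ⟨min γ⁻¹ (c * γ⁻¹ / (γ⁻¹ + 1) ^ A), by positivity, fun n hn => ?_⟩
  have hn' : (1 : ℝ) ≤ n := by exact_mod_cast hn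
  have hnA : (1 : ℝ) ≤ (n : ℝ) ^ A := one_le_pow₀ hn'
  set k : ℤ := round (γ⁻¹ * n) with hk
  have hk0 : 0 ≤ k := by
    rw [hk, round_eq]
    exact Int.floor_nonneg.mpr (by positivity)
  have hd : distNearestInt (γ⁻¹ * n) = |γ⁻¹ * n - k| := rfl
  have hdn := distNearestInt_nonneg (γ⁻¹ * n)
  lift k to ℕ using hk0 with m hm
  rcases Nat.eq_zero_or_pos m with h0 | hm1
  · refine (min_le_left _ _).trans ?_
    rw [hd, h0]
    simp only [Nat.cast_zero, Int.cast_zero, sub_zero]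
    rw [abs_of_nonneg (by positivity)]
    nlinarith [mul_le_mul hnA (mul_le_mul_of_nonneg_left hn' hγ'.le) (by linarith) (by positivity)]
  · refine (min_le_right _ _).trans ?_
    rw [div_le_iff₀ hK]
    have hdle : distNearestInt (γ⁻¹ * n) ≤ 1 / 2 := abs_sub_round _
    have hmle : (m : ℝ) ≤ (γ⁻¹ + 1) * n := by
      have := (abs_le.mp (hd ▸ hdle)).1
      push_cast at this
      nlinarith
    have h1 := h m hm1
    have h2 : distNearestInt (γ * m) ≤ γ * distNearestInt (γ⁻¹ * n) := by
      refine (distNearestInt_le_abs_sub _ n).trans (le_of_eq ?_)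
      rw [hd, ← abs_of_pos hγ, ← abs_mul, abs_of_pos hγ, ← abs_neg]
      congr 1
      push_cast
      field_simp
      ring
    have h3 : (m : ℝ) ^ A ≤ (γ⁻¹ + 1) ^ A * (n : ℝ) ^ A := by
      rw [← mul_pow]; gcongr
    have h4 : c ≤ (γ⁻¹ + 1) ^ A * (n : ℝ) ^ A * (γ * distNearestInt (γ⁻¹ * n)) :=
      h1.trans (mul_le_mul h3 h2 (distNearestInt_nonneg _) (by positivity))
    calc c * γ⁻¹ ≤ (γ⁻¹ + 1) ^ A * (n : ℝ) ^ A * (γ * distNearestInt (γ⁻¹ * n)) * γ⁻¹ := by gcongr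
      _ = _ := by field_simp

/-- A rational shift of bounded denominator costs only powers of that denominator:
`‖h (k γ + b / q)‖ ≥ q⁻¹ ‖q h k γ‖`. -/
theorem le_distNearestInt_mul_add_div {γ c : ℝ} {A : ℕ}
    (h : ∀ n : ℕ, 1 ≤ n → c ≤ (n : ℝ) ^ A * distNearestInt (γ * n))
    {k q : ℕ} (hk : 1 ≤ k) (hq : 1 ≤ q) (b : ℕ) {n : ℕ} (hn : 1 ≤ n) :
    c ≤ q * (q * n * k : ℝ) ^ A * distNearestInt (n * (k * γ + b / q)) := by
  have hq' : (0 : ℝ) < q := by exact_mod_cast hq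
  have h1 := h (q * n * k) (Nat.mul_pos (Nat.mul_pos hq hn) hk)
  have h2 : distNearestInt (γ * (q * n * k : ℕ)) ≤
      q * distNearestInt (n * (k * γ + b / q)) := by
    refine le_trans (le_of_eq ?_) (distNearestInt_nat_mul_le q _)
    rw [← distNearestInt_add_int _ (n * b : ℤ)]
    congr 1
    push_cast
    field_simp
  push_cast at h1
  calc c ≤ _ := h1
    _ ≤ (q * n * k : ℝ) ^ A * (q * distNearestInt (n * (k * γ + b / q))) := by
      gcongr
      simpa using h2
    _ = _ := by ring

/-- A set of positive integers up to `n` in which distinct elements differ by at least `L` has at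
most `n / L + 1` elements. -/
theorem card_le_of_spaced {n L : ℕ} (hL : 1 ≤ L) (s : Finset ℕ) (hs : ∀ x ∈ s, x ≤ n)
    (hsp : ∀ x ∈ s, ∀ y ∈ s, x < y → L ≤ y - x) : (s.card : ℝ) ≤ n / L + 1 := by
  have h1 : s.card ≤ (Finset.range (n / L + 1)).card := by
    refine Finset.card_le_card_of_injOn (· / L) (fun x hx => ?_) ?_
    · simpa [Nat.lt_succ_iff] using Nat.div_le_div_right (hs x hx)
    · have key : ∀ x ∈ s, ∀ y ∈ s, x < y → x / L ≠ y / L := by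
        intro x hx y hy hxy he
        have h1 := hsp x hx y hy hxy
        have h2 : (x + L) / L ≤ y / L := Nat.div_le_div_right (by omega)
        rw [Nat.add_div_right _ hL] at h2
        omega
      intro x hx y hy he
      rcases lt_trichotomy x y with h | h | h
      · exact absurd he (key x hx y hy h)
      · exact h
      · exact absurd he.symm (key y hy x hx h)
  rw [Finset.card_range] at h1
  calc (s.card : ℝ) ≤ ((n / L + 1 : ℕ) : ℝ) := by exact_mod_cast h1
    _ ≤ n / L + 1 := by
      push_cast
      gcongr
      exact Nat.cast_div_le

/-! ### Geometric sums of additive characters -/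

/-- The additive character `e(x) = exp(2πix)` of `ℝ / ℤ`. -/
noncomputable def addChar (x : ℝ) : ℂ := Complex.exp (2 * Real.pi * x * Complex.I)

theorem addChar_add (x y : ℝ) : addChar (x + y) = addChar x * addChar y := by
  rw [addChar, addChar, addChar, ← Complex.exp_add]
  congr 1
  push_cast
  ring

theorem addChar_nat_mul (n : ℕ) (x : ℝ) : addChar (n * x) = addChar x ^ n := by
  rw [addChar, addChar, ← Complex.exp_nat_mul]
  congr 1
  push_cast
  ring

theorem norm_addChar (x : ℝ) : ‖addChar x‖ = 1 := by
  rw [addChar, show (2 * Real.pi * x * Complex.I : ℂ) = ((2 * Real.pi * x : ℝ) : ℂ) * Complex.I by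
    push_cast; ring]
  exact Complex.norm_exp_ofReal_mul_I _

theorem addChar_int (n : ℤ) : addChar n = 1 := by
  rw [addChar, show (2 * Real.pi * ((n : ℝ) : ℂ) * Complex.I : ℂ) = n * (2 * Real.pi * Complex.I) by
    push_cast; ring]
  exact Complex.exp_int_mul_two_pi_mul_I n

theorem conj_addChar (x : ℝ) : (starRingEnd ℂ) (addChar x) = addChar (-x) := by
  rw [addChar, addChar, ← Complex.exp_conj]
  congr 1
  simp [map_ofNat]

theorem re_addChar (x : ℝ) : (addChar x).re = Real.cos (2 * Real.pi * x) := by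
  rw [addChar, show (2 * Real.pi * x * Complex.I : ℂ) = ((2 * Real.pi * x : ℝ) : ℂ) * Complex.I by
    push_cast; ring]
  exact Complex.exp_ofReal_mul_I_re _

theorem distNearestInt_le_norm_addChar_sub_one (x : ℝ) :
    4 * distNearestInt x ≤ ‖addChar x - 1‖ := by
  set y : ℝ := x - round x with hy
  have h1 : addChar x = addChar y := by
    have : x = y + (round x : ℤ) := by rw [hy]; ring
    rw [this, addChar_add, addChar_int, mul_one]
  have h2 : |y| ≤ 1 / 2 := abs_sub_round x
  have h3 : ‖addChar y - 1‖ = 2 * |Real.sin (Real.pi * y)| := by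
    rw [addChar, show (2 * Real.pi * y * Complex.I : ℂ) = Complex.I * ((2 * Real.pi * y : ℝ) : ℂ) by
      push_cast; ring, Complex.norm_exp_I_mul_ofReal_sub_one, norm_mul]
    simp only [Real.norm_eq_abs]
    rw [abs_of_pos (two_pos : (0 : ℝ) < 2)]
    congr 3
    ring
  have h4 : 2 * |y| ≤ |Real.sin (Real.pi * y)| := by
    have hpi := Real.pi_pos
    rw [Real.abs_sin_eq_sin_abs_of_abs_le_pi, abs_mul, abs_of_pos hpi]
    · have := Real.mul_le_sin (x := Real.pi * |y|) (by positivity) (by nlinarith)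
      calc 2 * |y| = 2 / Real.pi * (Real.pi * |y|) := by field_simp
        _ ≤ _ := this
    · rw [abs_mul, abs_of_pos hpi]
      nlinarith
  rw [h1, h3]
  change 4 * |y| ≤ _
  linarith

theorem norm_sum_addChar_le (a b : ℕ) {x η : ℝ} (hη : 0 < η) (h : η ≤ distNearestInt x) :
    ‖∑ n ∈ Finset.Ioc a b, addChar (n * x)‖ ≤ η⁻¹ := by
  rcases le_or_gt b a with hab | hab
  · rw [Finset.Ioc_eq_empty (by omega)]
    simpa using hη.le
  have hd := distNearestInt_le_norm_addChar_sub_one x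
  have hne : addChar x ≠ 1 := by
    intro h1
    rw [h1, sub_self, norm_zero] at hd
    linarith
  have hpos : 0 < ‖addChar x - 1‖ := norm_pos_iff.mpr (sub_ne_zero.mpr hne)
  have hS : ∑ n ∈ Finset.Ioc a b, addChar (n * x) =
      (addChar x ^ (b + 1) - addChar x ^ (a + 1)) / (addChar x - 1) := by
    rw [← geom_sum_Ico hne (by omega)]
    refine Finset.sum_congr ?_ fun n _ => addChar_nat_mul n x
    ext n
    simp only [Finset.mem_Ioc, Finset.mem_Ico]
    omega
  rw [hS, norm_div, div_le_iff₀ hpos]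
  have h2 : ‖addChar x ^ (b + 1) - addChar x ^ (a + 1)‖ ≤ 2 := by
    refine (norm_sub_le _ _).trans ?_
    rw [norm_pow, norm_pow, norm_addChar]
    norm_num
  calc _ ≤ (2 : ℝ) := h2
    _ ≤ η⁻¹ * (4 * η) := by field_simp; norm_num
    _ ≤ η⁻¹ * ‖addChar x - 1‖ := by gcongr; linarith

/-- Abel's inequality: a nondecreasing nonnegative weight multiplies a bound for all tails of a sum
by its last value. -/
theorem norm_sum_mul_le_of_monotone {g : ℕ → ℝ} (hg : Monotone g) (hg0 : ∀ n, 0 ≤ g n)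
    (z : ℕ → ℂ) {B : ℝ} (Y : ℕ) (hB : ∀ k, ‖∑ n ∈ Finset.Ioc k Y, z n‖ ≤ B) :
    ‖∑ n ∈ Finset.Ioc 0 Y, (g n : ℂ) * z n‖ ≤ g Y * B := by
  have key : ∀ t k : ℕ, k + t = Y →
      ‖∑ n ∈ Finset.Ioc k Y, ((g n - g k : ℝ) : ℂ) * z n‖ ≤ (g Y - g k) * B := by
    intro t
    induction t with
    | zero => intro k hk; simp [show k = Y by omega]
    | succ t ih =>
      intro k hk
      have h1 : ∑ n ∈ Finset.Ioc k Y, ((g n - g k : ℝ) : ℂ) * z n =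
          ∑ n ∈ Finset.Ioc (k + 1) Y, ((g n - g (k + 1) : ℝ) : ℂ) * z n +
            ((g (k + 1) - g k : ℝ) : ℂ) * ∑ n ∈ Finset.Ioc k Y, z n := by
        have hI : Finset.Ioc k Y = insert (k + 1) (Finset.Ioc (k + 1) Y) := by
          ext n
          simp only [Finset.mem_Ioc, Finset.mem_insert]
          omega
        rw [hI, Finset.sum_insert (by simp), Finset.sum_insert (by simp), mul_add, Finset.mul_sum,
          add_left_comm, ← Finset.sum_add_distrib]
        congr 1
        refine Finset.sum_congr rfl fun n _ => ?_
        push_cast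
        ring
      rw [h1]
      refine (norm_add_le _ _).trans ?_
      rw [norm_mul, Complex.norm_real, Real.norm_eq_abs,
        abs_of_nonneg (sub_nonneg.mpr (hg (Nat.le_succ k)))]
      have h2 := ih (k + 1) (by omega)
      have h3 := mul_le_mul_of_nonneg_left (hB k) (sub_nonneg.mpr (hg (Nat.le_succ k)))
      linarith
  have h0 := key Y 0 (by omega)
  have h1 : ∑ n ∈ Finset.Ioc 0 Y, (g n : ℂ) * z n =
      ∑ n ∈ Finset.Ioc 0 Y, ((g n - g 0 : ℝ) : ℂ) * z n +
        (g 0 : ℂ) * ∑ n ∈ Finset.Ioc 0 Y, z n := by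
    rw [Finset.mul_sum, ← Finset.sum_add_distrib]
    refine Finset.sum_congr rfl fun n _ => ?_
    push_cast
    ring
  rw [h1]
  refine (norm_add_le _ _).trans ?_
  rw [norm_mul, Complex.norm_real, Real.norm_eq_abs, abs_of_nonneg (hg0 0)]
  have h3 := mul_le_mul_of_nonneg_left (hB 0) (hg0 0)
  linarith

theorem norm_sum_nat_mul_addChar_le_sq (Y : ℕ) (x : ℝ) :
    ‖∑ n ∈ Finset.Ioc 0 Y, (n : ℂ) * addChar (n * x)‖ ≤ (Y : ℝ) * Y := by
  refine (norm_sum_le _ _).trans ?_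
  calc _ ≤ ∑ n ∈ Finset.Ioc 0 Y, (Y : ℝ) := by
        refine Finset.sum_le_sum fun n hn => ?_
        rw [norm_mul, norm_addChar, mul_one, Complex.norm_natCast]
        exact_mod_cast (Finset.mem_Ioc.mp hn).2
    _ = _ := by simp

theorem norm_sum_nat_mul_addChar_le (Y : ℕ) {x η : ℝ} (hη : 0 < η) (h : η ≤ distNearestInt x) :
    ‖∑ n ∈ Finset.Ioc 0 Y, (n : ℂ) * addChar (n * x)‖ ≤ Y * η⁻¹ := by
  have := norm_sum_mul_le_of_monotone (g := fun n => (n : ℝ)) Nat.mono_cast (fun n => n.cast_nonneg)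
    (fun n => addChar (n * x)) Y fun k => norm_sum_addChar_le k Y hη h
  simpa using this

/-! ### Bilinear exponential sums -/

/-- Multiples `nθ` that lie within `η` of a fixed number modulo one are sparse: if `‖hθ‖ ≥ 2η` for
`1 ≤ h < L`, every block of length `L` contains at most one. -/
theorem card_filter_dist_lt_le {θ η : ℝ} {L : ℕ} (hL : 1 ≤ L)
    (hθ : ∀ h : ℕ, 1 ≤ h → h < L → 2 * η ≤ distNearestInt (h * θ)) (x : ℝ) (n : ℕ)
    (s : Finset ℕ) (hs : ∀ m ∈ s, m ≤ n) (hsη : ∀ m ∈ s, distNearestInt (x - m * θ) < η) :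
    (s.card : ℝ) ≤ n / L + 1 := by
  refine card_le_of_spaced hL s hs fun a ha b hb hab => ?_
  by_contra! hlt
  have h1 := hθ (b - a) (by omega) hlt
  have h2 := distNearestInt_sub_le (x - a * θ) (x - b * θ)
  have h3 : x - a * θ - (x - b * θ) = ((b - a : ℕ) : ℝ) * θ := by
    rw [Nat.cast_sub hab.le]
    ring
  rw [h3] at h2
  linarith [hsη a ha, hsη b hb]

theorem sum_sum_le_two_mul_of_symm (s : Finset ℕ) (B : ℕ → ℕ → ℝ) (hB : ∀ m n, 0 ≤ B m n)
    (hsymm : ∀ m n, B m n = B n m) :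
    ∑ m ∈ s, ∑ n ∈ s, B m n ≤ 2 * ∑ m ∈ s, ∑ n ∈ s with n ≤ m, B m n := by
  have h1 : ∑ m ∈ s, ∑ n ∈ s with m ≤ n, B m n = ∑ m ∈ s, ∑ n ∈ s with n ≤ m, B m n := by
    simp only [Finset.sum_filter]
    rw [Finset.sum_comm]
    simp only [hsymm]
  rw [two_mul]
  nth_rewrite 2 [← h1]
  rw [← Finset.sum_add_distrib]
  refine Finset.sum_le_sum fun m _ => ?_
  rw [Finset.sum_filter, Finset.sum_filter, ← Finset.sum_add_distrib]
  refine Finset.sum_le_sum fun n _ => ?_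
  have := hB m n
  split_ifs <;> first | omega | linarith

theorem sum_Ioc_inv_le (M : ℕ) : ∑ n ∈ Finset.Ioc 0 M, (n : ℝ)⁻¹ ≤ 1 + Real.log M := by
  have h := harmonic_le_one_add_log M
  rw [harmonic_eq_sum_Icc] at h
  push_cast at h
  exact h

/-- The range `V < n ≤ M / U` of the inner variable of a bilinear sum over `mn ≤ M` whose variables
satisfy `m > U` and `n > V`. -/
def bilinearRange (M U V : ℕ) : Finset ℕ := (Finset.Ioc 0 M).filter fun n => V < n ∧ n * U ≤ M

/-- The mean square of the inner sums of a bilinear exponential sum, with weight `m`.  After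
expanding the square, the pairs `n₁, n₂` with `‖(n₁ - n₂)θ‖ < η`, which include the diagonal, are
sparse, and the other pairs give cancellation in the sum over `m`. -/
theorem sum_mul_norm_sq_le {M U V L : ℕ} (hU : 1 ≤ U) (hV : 1 ≤ V) (hL : 1 ≤ L) {θ η G : ℝ}
    (hη : 0 < η) (hθ : ∀ h : ℕ, 1 ≤ h → h < L → 2 * η ≤ distNearestInt (h * θ))
    {g : ℕ → ℝ} (hg : ∀ n ≤ M, |g n| ≤ G) :
    ∑ m ∈ Finset.Ioc 0 M, (m : ℝ) *
      ‖∑ n ∈ bilinearRange M U V with n ≤ M / m, (g n : ℂ) * addChar (m * (n * θ))‖ ^ 2 ≤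
    2 * G ^ 2 * (M : ℝ) ^ 2 * ((1 + Real.log M) / L + 1 / V + 1 / (U * η)) := by
  set s := bilinearRange M U V with hs
  have hsM : ∀ n ∈ s, n ≤ M ∧ 0 < n ∧ V < n ∧ n * U ≤ M := fun n hn => by
    have := Finset.mem_filter.mp hn
    exact ⟨(Finset.mem_Ioc.mp this.1).2, (Finset.mem_Ioc.mp this.1).1, this.2⟩
  set B : ℕ → ℕ → ℝ := fun a b =>
    if distNearestInt (a * θ - b * θ) < η then ((M : ℝ) / (max a b : ℕ)) ^ 2
    else (M : ℝ) / (max a b : ℕ) * η⁻¹ with hB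
  have hB0 : ∀ a b, 0 ≤ B a b := fun a b => by
    simp only [hB]
    split_ifs <;> positivity
  have hBsymm : ∀ a b, B a b = B b a := fun a b => by
    simp only [hB]
    rw [max_comm, ← distNearestInt_neg, neg_sub]
  -- expand the square and exchange the order of summation
  have hexp : ((∑ m ∈ Finset.Ioc 0 M, (m : ℝ) *
      ‖∑ n ∈ s with n ≤ M / m, (g n : ℂ) * addChar (m * (n * θ))‖ ^ 2 : ℝ) : ℂ) =
      ∑ a ∈ s, ∑ b ∈ s, ((g a * g b : ℝ) : ℂ) *
        ∑ m ∈ Finset.Ioc 0 (M / max a b), (m : ℂ) * addChar (m * (a * θ - b * θ)) := by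
    have h1 : ∀ m ∈ Finset.Ioc 0 M, (((m : ℝ) *
        ‖∑ n ∈ s with n ≤ M / m, (g n : ℂ) * addChar (m * (n * θ))‖ ^ 2 : ℝ) : ℂ) =
        ∑ a ∈ s, ∑ b ∈ s, if m ∈ Finset.Ioc 0 (M / max a b) then
          ((g a * g b : ℝ) : ℂ) * ((m : ℂ) * addChar (m * (a * θ - b * θ))) else 0 := by
      intro m hm
      have hm0 := (Finset.mem_Ioc.mp hm).1
      push_cast
      rw [← Complex.mul_conj', map_sum, Finset.sum_mul_sum, Finset.mul_sum, Finset.sum_filter]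
      refine Finset.sum_congr rfl fun a ha => ?_
      rw [Finset.mul_sum, Finset.sum_filter]
      split_ifs with hcase
      · refine Finset.sum_congr rfl fun b hb => ?_
        have hiff : m ∈ Finset.Ioc 0 (M / max a b) ↔ b ≤ M / m := by
          rw [Finset.mem_Ioc, Nat.le_div_iff_mul_le (by have := hsM a ha; omega),
            Nat.le_div_iff_mul_le hm0]
          rw [Nat.le_div_iff_mul_le hm0] at hcase
          rcases le_total a b with h | h
          · rw [max_eq_right h, mul_comm m b]; tauto
          · rw [max_eq_left h, mul_comm m a]
            have := Nat.mul_le_mul_right m h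
            exact ⟨fun _ => by omega, fun _ => ⟨hm0, hcase⟩⟩
        simp only [hiff]
        split_ifs
        · rw [map_mul, Complex.conj_ofReal, conj_addChar, mul_sub, sub_eq_add_neg, addChar_add]
          ring
        · rfl
      · refine (Finset.sum_eq_zero fun b hb => if_neg fun h => hcase ?_).symm
        rw [Finset.mem_Ioc, Nat.le_div_iff_mul_le (by have := hsM a ha; omega)] at h
        rw [Nat.le_div_iff_mul_le hm0, mul_comm]
        exact (Nat.mul_le_mul_left m (le_max_left a b)).trans h.2
    rw [Complex.ofReal_sum, Finset.sum_congr rfl h1, Finset.sum_comm]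
    refine Finset.sum_congr rfl fun a ha => ?_
    rw [Finset.sum_comm]
    refine Finset.sum_congr rfl fun b hb => ?_
    rw [← Finset.sum_filter, Finset.mul_sum]
    refine Finset.sum_congr ?_ fun m _ => rfl
    ext m
    simp only [Finset.mem_filter, Finset.mem_Ioc]
    have := Nat.div_le_self M (max a b)
    omega
  have hHB : ∀ a b : ℕ, ‖∑ m ∈ Finset.Ioc 0 (M / max a b),
      (m : ℂ) * addChar (m * (a * θ - b * θ))‖ ≤ B a b := by
    intro a b
    have hY : ((M / max a b : ℕ) : ℝ) ≤ (M : ℝ) / (max a b : ℕ) := Nat.cast_div_le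
    simp only [hB]
    split_ifs with h
    · refine (norm_sum_nat_mul_addChar_le_sq _ _).trans ?_
      rw [sq]
      gcongr
    · refine (norm_sum_nat_mul_addChar_le _ hη (not_lt.mp h)).trans ?_
      gcongr
  have hG0 : 0 ≤ G := (abs_nonneg _).trans (hg 0 (Nat.zero_le _))
  have h1 : ∑ m ∈ Finset.Ioc 0 M, (m : ℝ) *
      ‖∑ n ∈ s with n ≤ M / m, (g n : ℂ) * addChar (m * (n * θ))‖ ^ 2 ≤
      G ^ 2 * ∑ a ∈ s, ∑ b ∈ s, B a b := by
    have h0 : ∀ x : ℝ, 0 ≤ x → x = ‖(x : ℂ)‖ := fun x hx => by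
      rw [Complex.norm_real, Real.norm_eq_abs, abs_of_nonneg hx]
    rw [h0 (∑ m ∈ Finset.Ioc 0 M, _) (Finset.sum_nonneg fun _ _ => by positivity), hexp,
      Finset.mul_sum]
    refine (norm_sum_le _ _).trans (Finset.sum_le_sum fun a ha => ?_)
    rw [Finset.mul_sum]
    refine (norm_sum_le _ _).trans (Finset.sum_le_sum fun b hb => ?_)
    rw [norm_mul, Complex.norm_real, Real.norm_eq_abs, abs_mul, sq]
    have h2 := hg a (hsM a ha).1
    have h3 := hg b (hsM b hb).1
    have h4 := hHB a b
    gcongr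
  -- for fixed `a`, the sum over `b ≤ a`
  have h2 : ∀ a ∈ s, ∑ b ∈ s with b ≤ a, B a b ≤
      (M : ℝ) ^ 2 / L * (a : ℝ)⁻¹ + (M : ℝ) ^ 2 * ((a : ℝ) ^ 2)⁻¹ + M / η := by
    intro a ha
    have ha0 : (0 : ℝ) < a := by exact_mod_cast (hsM a ha).2.1
    have hL' : (0 : ℝ) < L := by exact_mod_cast hL
    have h3 : ∀ b ∈ s.filter (· ≤ a), B a b ≤
        (if distNearestInt (a * θ - b * θ) < η then ((M : ℝ) / a) ^ 2 else 0) +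
          (M : ℝ) / a * η⁻¹ := by
      intro b hb
      simp only [hB]
      rw [max_eq_left (Finset.mem_filter.mp hb).2]
      split_ifs
      · have : 0 ≤ (M : ℝ) / a * η⁻¹ := by positivity
        linarith
      · linarith
    refine (Finset.sum_le_sum h3).trans ?_
    rw [Finset.sum_add_distrib, ← Finset.sum_filter, Finset.sum_const, Finset.sum_const,
      nsmul_eq_mul, nsmul_eq_mul]
    have h4 : (((s.filter (· ≤ a)).filter
        fun b : ℕ => distNearestInt (a * θ - b * θ) < η).card : ℝ) ≤ a / L + 1 :=
      card_filter_dist_lt_le hL hθ (a * θ) a _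
        (fun m hm => (Finset.mem_filter.mp (Finset.mem_filter.mp hm).1).2)
        (fun m hm => (Finset.mem_filter.mp hm).2)
    have h5 : ((s.filter (· ≤ a)).card : ℝ) ≤ a := by
      have : (s.filter (· ≤ a)) ⊆ Finset.Ioc 0 a := fun b hb => by
        rw [Finset.mem_filter] at hb
        exact Finset.mem_Ioc.mpr ⟨(hsM b hb.1).2.1, hb.2⟩
      simpa using (Nat.cast_le (α := ℝ)).mpr (Finset.card_le_card this)
    calc _ ≤ ((a : ℝ) / L + 1) * ((M : ℝ) / a) ^ 2 + a * ((M : ℝ) / a * η⁻¹) := by gcongr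
      _ = _ := by field_simp
  have h3 : ∑ a ∈ s, ∑ b ∈ s with b ≤ a, B a b ≤
      (M : ℝ) ^ 2 * ((1 + Real.log M) / L + 1 / V + 1 / (U * η)) := by
    refine (Finset.sum_le_sum h2).trans ?_
    rw [Finset.sum_add_distrib, Finset.sum_add_distrib, ← Finset.mul_sum, ← Finset.mul_sum,
      Finset.sum_const, nsmul_eq_mul]
    have h4 : ∑ a ∈ s, (a : ℝ)⁻¹ ≤ 1 + Real.log M :=
      (Finset.sum_le_sum_of_subset_of_nonneg (Finset.filter_subset _ _)
        fun _ _ _ => by positivity).trans (sum_Ioc_inv_le M)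
    have h5 : ∑ a ∈ s, ((a : ℝ) ^ 2)⁻¹ ≤ (V : ℝ)⁻¹ := by
      rcases le_or_gt M V with hMV | hMV
      · have : s = ∅ := Finset.eq_empty_of_forall_notMem fun n hn => by
          have := hsM n hn
          omega
        rw [this]
        simp
      · have hsub : s ⊆ Finset.Ioc V M := fun n hn => by
          have := hsM n hn
          exact Finset.mem_Ioc.mpr ⟨by omega, by omega⟩
        refine (Finset.sum_le_sum_of_subset_of_nonneg hsub fun _ _ _ => by positivity).trans ?_
        have := sum_Ioc_inv_sq_le_sub (α := ℝ) (k := V) (n := M) (by omega) hMV.le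
        have h6 : (0 : ℝ) ≤ (M : ℝ)⁻¹ := by positivity
        linarith
    have h6 : (s.card : ℝ) ≤ M / U := by
      have hsub : s ⊆ Finset.Ioc 0 (M / U) := fun n hn => by
        have := hsM n hn
        exact Finset.mem_Ioc.mpr ⟨this.2.1, (Nat.le_div_iff_mul_le hU).mpr this.2.2.2⟩
      have h7 := (Nat.cast_le (α := ℝ)).mpr (Finset.card_le_card hsub)
      rw [Nat.card_Ioc, Nat.sub_zero] at h7
      exact h7.trans Nat.cast_div_le
    have hU' : (0 : ℝ) < U := by exact_mod_cast hU
    calc _ ≤ (M : ℝ) ^ 2 / L * (1 + Real.log M) + (M : ℝ) ^ 2 * (V : ℝ)⁻¹ + M / U * (M / η) := by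
          gcongr
      _ = _ := by
          field_simp
  calc _ ≤ _ := h1
    _ ≤ G ^ 2 * (2 * ((M : ℝ) ^ 2 * ((1 + Real.log M) / L + 1 / V + 1 / (U * η)))) := by
      gcongr
      exact (sum_sum_le_two_mul_of_symm s B hB0 hBsymm).trans (by gcongr)
    _ = _ := by ring

/-- A bilinear exponential sum whose first variable exceeds `U` and whose second exceeds `V`.
Cauchy's inequality is applied with the weights `1 / m` and `m`, so that no dyadic decomposition is
needed. -/
theorem norm_bilinear_sum_sq_le {M U V L : ℕ} (hU : 1 ≤ U) (hV : 1 ≤ V) (hL : 1 ≤ L) {θ η G : ℝ}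
    (hη : 0 < η) (hθ : ∀ h : ℕ, 1 ≤ h → h < L → 2 * η ≤ distNearestInt (h * θ))
    {f g : ℕ → ℝ} (hf : ∀ m, |f m| ≤ 1) (hfU : ∀ m ≤ U, f m = 0)
    (hg : ∀ n ≤ M, |g n| ≤ G) (hgV : ∀ n ≤ V, g n = 0) :
    ‖∑ m ∈ Finset.Ioc 0 M, (f m : ℂ) *
      ∑ n ∈ Finset.Ioc 0 (M / m), (g n : ℂ) * addChar (m * (n * θ))‖ ^ 2 ≤
    2 * G ^ 2 * (M : ℝ) ^ 2 * (1 + Real.log M) *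
      ((1 + Real.log M) / L + 1 / V + 1 / (U * η)) := by
  set S : ℕ → ℝ := fun m =>
    ‖∑ n ∈ bilinearRange M U V with n ≤ M / m, (g n : ℂ) * addChar (m * (n * θ))‖ with hS
  have h1 : ‖∑ m ∈ Finset.Ioc 0 M, (f m : ℂ) *
      ∑ n ∈ Finset.Ioc 0 (M / m), (g n : ℂ) * addChar (m * (n * θ))‖ ≤
      ∑ m ∈ Finset.Ioc 0 M, S m := by
    refine (norm_sum_le _ _).trans (Finset.sum_le_sum fun m hm => ?_)
    rcases le_or_gt m U with hmU | hmU
    · rw [hfU m hmU]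
      simp [hS]
    · rw [norm_mul, Complex.norm_real, Real.norm_eq_abs]
      have h2 : ∑ n ∈ Finset.Ioc 0 (M / m), (g n : ℂ) * addChar (m * (n * θ)) =
          ∑ n ∈ bilinearRange M U V with n ≤ M / m, (g n : ℂ) * addChar (m * (n * θ)) := by
        symm
        refine Finset.sum_subset (fun n hn => ?_) fun n hn hn' => ?_
        · simp only [bilinearRange, Finset.mem_filter, Finset.mem_Ioc] at hn ⊢
          omega
        · have hnV : n ≤ V := by
            by_contra! hlt
            refine hn' ?_
            simp only [bilinearRange, Finset.mem_filter, Finset.mem_Ioc] at hn ⊢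
            have h3 := (Nat.le_div_iff_mul_le (by omega)).mp hn.2
            have h4 : n * U ≤ n * m := Nat.mul_le_mul_left n hmU.le
            have h5 := Nat.div_le_self M m
            exact ⟨⟨⟨hn.1, by omega⟩, hlt, by omega⟩, hn.2⟩
          rw [hgV n hnV]
          simp
      rw [h2]
      have := mul_le_mul_of_nonneg_right (hf m) (norm_nonneg
        (∑ n ∈ bilinearRange M U V with n ≤ M / m, (g n : ℂ) * addChar (m * (n * θ))))
      simpa [hS] using this
  have h2 : (∑ m ∈ Finset.Ioc 0 M, S m) ^ 2 ≤
      (∑ m ∈ Finset.Ioc 0 M, (m : ℝ)⁻¹) * ∑ m ∈ Finset.Ioc 0 M, (m : ℝ) * S m ^ 2 := by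
    refine Finset.sum_sq_le_sum_mul_sum_of_sq_le_mul _ (fun m _ => by positivity)
      (fun m _ => by positivity) fun m hm => le_of_eq ?_
    have : (m : ℝ) ≠ 0 := by exact_mod_cast (Finset.mem_Ioc.mp hm).1.ne'
    field_simp
  have h3 := sum_mul_norm_sq_le hU hV hL hη hθ hg
  have h4 := sum_Ioc_inv_le M
  have h5 : 0 ≤ 1 + Real.log M := (Finset.sum_nonneg fun n _ => by positivity).trans h4
  calc _ ≤ (∑ m ∈ Finset.Ioc 0 M, S m) ^ 2 := by gcongr
    _ ≤ _ := h2
    _ ≤ (1 + Real.log M) * (2 * G ^ 2 * (M : ℝ) ^ 2 *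
        ((1 + Real.log M) / L + 1 / V + 1 / (U * η))) :=
      mul_le_mul h4 h3 (Finset.sum_nonneg fun m _ => by positivity) h5
    _ = _ := by ring

/-! ### Vaughan's identity -/

open ArithmeticFunction in
/-- The sum of `(f * g)(n) F(n)` over `n ≤ M`, written as a double sum. -/
theorem sum_Ioc_mul_mul_eq_sum_sum (f g : ArithmeticFunction ℝ) (F : ℕ → ℂ) (M : ℕ) :
    ∑ n ∈ Finset.Ioc 0 M, ((f * g) n : ℂ) * F n =
      ∑ m ∈ Finset.Ioc 0 M, (f m : ℂ) * ∑ n ∈ Finset.Ioc 0 (M / m), (g n : ℂ) * F (m * n) := by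
  have h1 : ∀ n ∈ Finset.Ioc 0 M, ((f * g) n : ℂ) * F n =
      ∑ x ∈ Finset.Ioc 0 M ×ˢ Finset.Ioc 0 M,
        if x.1 * x.2 = n then (f x.1 : ℂ) * (g x.2 : ℂ) * F (x.1 * x.2) else 0 := by
    intro n hn
    rw [Finset.mem_Ioc] at hn
    rw [mul_apply, Nat.divisorsAntidiagonal_eq_prod_filter_of_le hn.1.ne' hn.2,
      ← Finset.sum_filter, Complex.ofReal_sum, Finset.sum_mul]
    refine Finset.sum_congr rfl fun x hx => ?_
    rw [(Finset.mem_filter.mp hx).2, Complex.ofReal_mul]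
  rw [Finset.sum_congr rfl h1, Finset.sum_comm, Finset.sum_product]
  refine Finset.sum_congr rfl fun m hm => ?_
  rw [Finset.mem_Ioc] at hm
  rw [Finset.mul_sum]
  have hsub : Finset.Ioc 0 (M / m) ⊆ Finset.Ioc 0 M :=
    Finset.Ioc_subset_Ioc_right (Nat.div_le_self M m)
  rw [← Finset.sum_subset hsub]
  · refine Finset.sum_congr rfl fun n hn => ?_
    rw [Finset.mem_Ioc, Nat.le_div_iff_mul_le hm.1, mul_comm n m] at hn
    rw [Finset.sum_ite_eq, if_pos (Finset.mem_Ioc.mpr ⟨Nat.mul_pos hm.1 hn.1, hn.2⟩), mul_assoc]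
  · intro n hn hn'
    rw [Finset.mem_Ioc] at hn
    rw [Finset.mem_Ioc, Nat.le_div_iff_mul_le hm.1, mul_comm n m] at hn'
    rw [Finset.sum_ite_eq, if_neg]
    rw [Finset.mem_Ioc]
    tauto

/-- A double sum over `m ≤ D` with a smooth inner sum. -/
theorem norm_linear_sum_le {M D : ℕ} {θ η F G : ℝ} (hη : 0 < η)
    (hθ : ∀ h : ℕ, 1 ≤ h → h ≤ D → η ≤ distNearestInt (h * θ))
    {f g : ℕ → ℝ} (hf : ∀ m ≤ M, |f m| ≤ F) (hfD : ∀ m, D < m → f m = 0)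
    (hg : Monotone g) (hg0 : ∀ n, 0 ≤ g n) (hgG : g M ≤ G) :
    ‖∑ m ∈ Finset.Ioc 0 M, (f m : ℂ) *
      ∑ n ∈ Finset.Ioc 0 (M / m), (g n : ℂ) * addChar (m * (n * θ))‖ ≤ D * (F * (G * η⁻¹)) := by
  have hF0 : 0 ≤ F := (abs_nonneg _).trans (hf 0 (Nat.zero_le _))
  have hG0 : 0 ≤ G := (hg0 M).trans hgG
  have h1 : ∀ m ∈ Finset.Ioc 0 M, ‖(f m : ℂ) *
      ∑ n ∈ Finset.Ioc 0 (M / m), (g n : ℂ) * addChar (m * (n * θ))‖ ≤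
      if m ∈ Finset.Ioc 0 D then F * (G * η⁻¹) else 0 := by
    intro m hm
    rw [Finset.mem_Ioc] at hm
    split_ifs with h
    · rw [Finset.mem_Ioc] at h
      rw [norm_mul, Complex.norm_real, Real.norm_eq_abs]
      have h2 : ‖∑ n ∈ Finset.Ioc 0 (M / m), (g n : ℂ) * addChar (m * (n * θ))‖ ≤
          g (M / m) * η⁻¹ := by
        refine norm_sum_mul_le_of_monotone hg hg0 _ _ fun k => ?_
        have := norm_sum_addChar_le k (M / m) hη (hθ m h.1 h.2)
        simpa only [mul_left_comm] using this
      have h3 : g (M / m) ≤ G := (hg (Nat.div_le_self M m)).trans hgG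
      have h4 := hf m hm.2
      calc _ ≤ F * (g (M / m) * η⁻¹) := by gcongr
        _ ≤ _ := by gcongr
    · have : f m = 0 := hfD m (by rw [Finset.mem_Ioc] at h; omega)
      simp [this]
  refine (norm_sum_le _ _).trans ((Finset.sum_le_sum h1).trans ?_)
  rw [← Finset.sum_filter, Finset.sum_const, nsmul_eq_mul]
  have h2 : (((Finset.Ioc 0 M).filter (· ∈ Finset.Ioc 0 D)).card : ℝ) ≤ D := by
    have : ((Finset.Ioc 0 M).filter (· ∈ Finset.Ioc 0 D)) ⊆ Finset.Ioc 0 D := fun x hx =>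
      (Finset.mem_filter.mp hx).2
    simpa using (Nat.cast_le (α := ℝ)).mpr (Finset.card_le_card this)
  gcongr

/-- The restriction of an arithmetic function to the integers up to `U`. -/
def truncate (f : ArithmeticFunction ℝ) (U : ℕ) : ArithmeticFunction ℝ :=
  ⟨fun n => if n ≤ U then f n else 0, by simp⟩

theorem truncate_apply (f : ArithmeticFunction ℝ) (U n : ℕ) :
    truncate f U n = if n ≤ U then f n else 0 := rfl

section Vaughan

open ArithmeticFunction ArithmeticFunction.Moebius ArithmeticFunction.zeta

theorem arithmeticFunction_sub_apply (f g : ArithmeticFunction ℝ) (n : ℕ) :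
    (f - g) n = f n - g n := by
  rw [sub_eq_add_neg, ArithmeticFunction.add_apply]
  rfl

theorem vaughan_identity (U V : ℕ) :
    (Λ : ArithmeticFunction ℝ) = truncate Λ V + truncate (μ : ArithmeticFunction ℝ) U * log -
      truncate (μ : ArithmeticFunction ℝ) U * truncate Λ V * (ζ : ArithmeticFunction ℝ) +
      ((μ : ArithmeticFunction ℝ) - truncate (μ : ArithmeticFunction ℝ) U) *
        ((Λ - truncate Λ V) * (ζ : ArithmeticFunction ℝ)) := by
  have h1 : (μ : ArithmeticFunction ℝ) * (ζ : ArithmeticFunction ℝ) = 1 := coe_moebius_mul_coe_zeta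
  have h2 : Λ * (ζ : ArithmeticFunction ℝ) = log := vonMangoldt_mul_zeta
  linear_combination (-(Λ - truncate Λ V)) * h1 + truncate (μ : ArithmeticFunction ℝ) U * h2

theorem abs_truncate_moebius_le (U n : ℕ) : |truncate (μ : ArithmeticFunction ℝ) U n| ≤ 1 := by
  rw [truncate_apply]
  split_ifs
  · rw [intCoe_apply]
    exact_mod_cast abs_moebius_le_one
  · simp

theorem abs_moebius_sub_truncate_le (U n : ℕ) :
    |((μ : ArithmeticFunction ℝ) - truncate (μ : ArithmeticFunction ℝ) U) n| ≤ 1 := by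
  rw [arithmeticFunction_sub_apply, truncate_apply, intCoe_apply]
  split_ifs
  · simp
  · rw [sub_zero]
    exact_mod_cast abs_moebius_le_one

theorem truncate_vonMangoldt_nonneg (V n : ℕ) : 0 ≤ truncate Λ V n := by
  rw [truncate_apply]
  split_ifs
  · exact vonMangoldt_nonneg
  · simp

theorem truncate_vonMangoldt_le (V n : ℕ) : truncate Λ V n ≤ Λ n := by
  rw [truncate_apply]
  split_ifs
  · exact le_rfl
  · exact vonMangoldt_nonneg

theorem abs_truncate_mul_truncate_le (U V n : ℕ) :
    |(truncate (μ : ArithmeticFunction ℝ) U * truncate Λ V) n| ≤ Real.log n := by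
  rw [mul_apply]
  refine (Finset.abs_sum_le_sum_abs _ _).trans ?_
  have h1 : Real.log n = ∑ x ∈ n.divisorsAntidiagonal, Λ x.2 := by
    rw [← vonMangoldt_sum, Nat.sum_divisorsAntidiagonal' (f := fun _ j => Λ j)]
  rw [h1]
  refine Finset.sum_le_sum fun x _ => ?_
  rw [abs_mul, abs_of_nonneg (truncate_vonMangoldt_nonneg V x.2)]
  calc _ ≤ 1 * truncate Λ V x.2 := by
        gcongr
        · exact truncate_vonMangoldt_nonneg V x.2
        · exact abs_truncate_moebius_le U x.1
    _ ≤ _ := by rw [one_mul]; exact truncate_vonMangoldt_le V x.2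

theorem truncate_mul_truncate_eq_zero (f g : ArithmeticFunction ℝ) {U V n : ℕ} (h : U * V < n) :
    (truncate f U * truncate g V) n = 0 := by
  rw [mul_apply]
  refine Finset.sum_eq_zero fun x hx => ?_
  rw [truncate_apply, truncate_apply]
  split_ifs with h1 h2
  · have := Nat.mul_le_mul h1 h2
    rw [(Nat.mem_divisorsAntidiagonal.mp hx).1] at this
    omega
  all_goals simp

theorem abs_vonMangoldt_sub_truncate_mul_zeta_le (V n : ℕ) :
    |((Λ - truncate Λ V) * (ζ : ArithmeticFunction ℝ)) n| ≤ Real.log n := by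
  rw [coe_mul_zeta_apply, ← vonMangoldt_sum]
  refine (Finset.abs_sum_le_sum_abs _ _).trans (Finset.sum_le_sum fun i _ => ?_)
  rw [arithmeticFunction_sub_apply, abs_of_nonneg (sub_nonneg.mpr (truncate_vonMangoldt_le V i))]
  linarith [truncate_vonMangoldt_nonneg V i]

theorem vonMangoldt_sub_truncate_mul_zeta_eq_zero {V n : ℕ} (h : n ≤ V) :
    ((Λ - truncate Λ V) * (ζ : ArithmeticFunction ℝ)) n = 0 := by
  rw [coe_mul_zeta_apply]
  refine Finset.sum_eq_zero fun i hi => ?_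
  rw [arithmeticFunction_sub_apply, truncate_apply, if_pos ((Nat.divisor_le hi).trans h), sub_self]

theorem log_natCast_monotone : Monotone fun n : ℕ => Real.log n := by
  intro a b hab
  rcases Nat.eq_zero_or_pos a with rfl | ha
  · simpa using Real.log_natCast_nonneg b
  · exact Real.log_le_log (by exact_mod_cast ha) (by exact_mod_cast hab)

/-- Vinogradov's bound for exponential sums over primes, in terms of lower bounds for `‖hθ‖`: a weak
one in a short range of `h`, for the bilinear sums, and one in the range `h ≤ U V`. -/
theorem norm_sum_vonMangoldt_mul_addChar_le {M U V L : ℕ} (hU : 1 ≤ U) {θ η η' r ℓ : ℝ}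
    (hη : 0 < η) (hη' : 0 < η') (hr : 0 < r) (hℓ : 1 ≤ ℓ) (hM : Real.log M ≤ ℓ)
    (hV : 1 ≤ V) (hL : 1 ≤ L)
    (hLr : r ^ 2 ≤ L) (hVr : r ^ 2 ≤ V) (hUr : r ^ 2 ≤ U * η)
    (hθ : ∀ h : ℕ, 1 ≤ h → h < L → 2 * η ≤ distNearestInt (h * θ))
    (hθ' : ∀ h : ℕ, 1 ≤ h → h ≤ U * V → η' ≤ distNearestInt (h * θ)) :
    ‖∑ n ∈ Finset.Ioc 0 M, (Λ n : ℂ) * addChar (n * θ)‖ ≤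
      V * ℓ + 2 * (U * V * (ℓ * η'⁻¹)) + 4 * ℓ ^ 2 * M / r := by
  have hlog : ∀ n ≤ M, Real.log n ≤ ℓ := fun n hn => (log_natCast_monotone hn).trans hM
  set m₁ := truncate (μ : ArithmeticFunction ℝ) U with hm₁
  set l₁ := truncate Λ V with hl₁
  have hconv : ∀ f g : ArithmeticFunction ℝ, ∑ n ∈ Finset.Ioc 0 M,
      ((f * g) n : ℂ) * addChar (n * θ) = ∑ m ∈ Finset.Ioc 0 M, (f m : ℂ) *
        ∑ n ∈ Finset.Ioc 0 (M / m), (g n : ℂ) * addChar (m * (n * θ)) := by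
    intro f g
    rw [sum_Ioc_mul_mul_eq_sum_sum f g (fun n => addChar (n * θ))]
    simp only [Nat.cast_mul, mul_assoc]
  have hsplit : ∑ n ∈ Finset.Ioc 0 M, (Λ n : ℂ) * addChar (n * θ) =
      ∑ n ∈ Finset.Ioc 0 M, (l₁ n : ℂ) * addChar (n * θ) +
      ∑ n ∈ Finset.Ioc 0 M, ((m₁ * log) n : ℂ) * addChar (n * θ) -
      ∑ n ∈ Finset.Ioc 0 M,
        ((m₁ * l₁ * (ζ : ArithmeticFunction ℝ)) n : ℂ) * addChar (n * θ) +
      ∑ n ∈ Finset.Ioc 0 M, ((((μ : ArithmeticFunction ℝ) - m₁) *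
        ((Λ - l₁) * (ζ : ArithmeticFunction ℝ))) n : ℂ) * addChar (n * θ) := by
    rw [← Finset.sum_add_distrib, ← Finset.sum_sub_distrib, ← Finset.sum_add_distrib]
    refine Finset.sum_congr rfl fun n _ => ?_
    nth_rewrite 1 [vaughan_identity U V]
    rw [ArithmeticFunction.add_apply, arithmeticFunction_sub_apply, ArithmeticFunction.add_apply]
    push_cast
    ring
  have hD : ∀ h : ℕ, 1 ≤ h → h ≤ U → η' ≤ distNearestInt (h * θ) := fun h h1 h2 =>
    hθ' h h1 (h2.trans (Nat.le_mul_of_pos_right U hV))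
  -- the four pieces
  have b1 : ‖∑ n ∈ Finset.Ioc 0 M, (l₁ n : ℂ) * addChar (n * θ)‖ ≤ V * ℓ := by
    have h1 : ∀ n ∈ Finset.Ioc 0 M, ‖(l₁ n : ℂ) * addChar (n * θ)‖ ≤
        if n ∈ Finset.Ioc 0 V then ℓ else 0 := by
      intro n hn
      rw [Finset.mem_Ioc] at hn
      rw [norm_mul, norm_addChar, mul_one, Complex.norm_real, Real.norm_eq_abs,
        abs_of_nonneg (truncate_vonMangoldt_nonneg V n)]
      split_ifs with h
      · exact (truncate_vonMangoldt_le V n).trans (vonMangoldt_le_log.trans (hlog n hn.2))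
      · rw [truncate_apply, if_neg]
        rw [Finset.mem_Ioc] at h
        omega
    refine (norm_sum_le _ _).trans ((Finset.sum_le_sum h1).trans ?_)
    rw [← Finset.sum_filter, Finset.sum_const, nsmul_eq_mul]
    have h2 : (((Finset.Ioc 0 M).filter (· ∈ Finset.Ioc 0 V)).card : ℝ) ≤ V := by
      have : ((Finset.Ioc 0 M).filter (· ∈ Finset.Ioc 0 V)) ⊆ Finset.Ioc 0 V := fun x hx =>
        (Finset.mem_filter.mp hx).2
      simpa using (Nat.cast_le (α := ℝ)).mpr (Finset.card_le_card this)
    gcongr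
  have b2 : ‖∑ n ∈ Finset.Ioc 0 M, ((m₁ * log) n : ℂ) * addChar (n * θ)‖ ≤
      U * V * (ℓ * η'⁻¹) := by
    rw [hconv]
    have h1 := norm_linear_sum_le (M := M) hη' hD (f := m₁) (g := log) (F := 1) (G := ℓ)
      (fun m _ => abs_truncate_moebius_le U m)
      (fun m hm => by rw [hm₁, truncate_apply, if_neg (by omega)])
      (fun a b h => by simpa only [log_apply] using log_natCast_monotone h)
      (fun n => by simpa only [log_apply] using Real.log_natCast_nonneg n)
      (by simpa only [log_apply] using hM)
    refine h1.trans ?_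
    have hV' : (1 : ℝ) ≤ V := by exact_mod_cast hV
    rw [one_mul]
    have : (U : ℝ) ≤ U * V := le_mul_of_one_le_right (by positivity) hV'
    gcongr
  have b3 : ‖∑ n ∈ Finset.Ioc 0 M,
      ((m₁ * l₁ * (ζ : ArithmeticFunction ℝ)) n : ℂ) * addChar (n * θ)‖ ≤
      U * V * (ℓ * η'⁻¹) := by
    rw [hconv]
    have hz : ∀ n : ℕ, (ζ : ArithmeticFunction ℝ) n = if n = 0 then 0 else 1 := fun n => by
      rw [natCoe_apply, zeta_apply]
      split_ifs <;> simp
    have h1 := norm_linear_sum_le (M := M) (D := U * V) hη' hθ' (f := ⇑(m₁ * l₁))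
      (g := (ζ : ArithmeticFunction ℝ)) (F := ℓ) (G := 1)
      (fun m hm => (abs_truncate_mul_truncate_le U V m).trans (hlog m hm))
      (fun m hm => truncate_mul_truncate_eq_zero _ _ hm)
      (fun a b h => by
        simp only [hz]
        split_ifs <;> first | omega | norm_num)
      (fun n => by rw [hz]; split_ifs <;> norm_num)
      (by rw [hz]; split_ifs <;> norm_num)
    refine h1.trans (le_of_eq ?_)
    push_cast
    ring
  have b4 : ‖∑ n ∈ Finset.Ioc 0 M, ((((μ : ArithmeticFunction ℝ) - m₁) *
      ((Λ - l₁) * (ζ : ArithmeticFunction ℝ))) n : ℂ) * addChar (n * θ)‖ ≤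
      4 * ℓ ^ 2 * M / r := by
    rw [hconv]
    have h1 := norm_bilinear_sum_sq_le (M := M) hU hV hL hη hθ
      (f := ⇑((μ : ArithmeticFunction ℝ) - m₁))
      (g := ⇑((Λ - l₁) * (ζ : ArithmeticFunction ℝ)))
      (G := ℓ) (abs_moebius_sub_truncate_le U)
      (fun m hm => by rw [arithmeticFunction_sub_apply, hm₁, truncate_apply, if_pos hm, sub_self])
      (fun n hn => (abs_vonMangoldt_sub_truncate_mul_zeta_le V n).trans (hlog n hn))
      (fun n hn => vonMangoldt_sub_truncate_mul_zeta_eq_zero hn)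
    refine le_of_sq_le_sq (h1.trans ?_) (by positivity)
    have hr2 : 0 < r ^ 2 := by positivity
    have e1 : (1 + Real.log M) / L ≤ 2 * ℓ / r ^ 2 := by gcongr; linarith
    have e2 : 1 / (V : ℝ) ≤ ℓ / r ^ 2 := by gcongr
    have e3 : 1 / (U * η) ≤ ℓ / r ^ 2 := by gcongr
    have hlog0 := Real.log_natCast_nonneg M
    calc _ ≤ 2 * ℓ ^ 2 * (M : ℝ) ^ 2 * (ℓ + ℓ) * (2 * ℓ / r ^ 2 + ℓ / r ^ 2 + ℓ / r ^ 2) := by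
          gcongr
      _ = _ := by field_simp; ring
  rw [hsplit]
  have t1 := norm_add_le (∑ n ∈ Finset.Ioc 0 M, (l₁ n : ℂ) * addChar (n * θ) +
      ∑ n ∈ Finset.Ioc 0 M, ((m₁ * log) n : ℂ) * addChar (n * θ) -
      ∑ n ∈ Finset.Ioc 0 M,
        ((m₁ * l₁ * (ζ : ArithmeticFunction ℝ)) n : ℂ) * addChar (n * θ))
      (∑ n ∈ Finset.Ioc 0 M, ((((μ : ArithmeticFunction ℝ) - m₁) *
        ((Λ - l₁) * (ζ : ArithmeticFunction ℝ))) n : ℂ) * addChar (n * θ))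
  have t2 := norm_sub_le (∑ n ∈ Finset.Ioc 0 M, (l₁ n : ℂ) * addChar (n * θ) +
      ∑ n ∈ Finset.Ioc 0 M, ((m₁ * log) n : ℂ) * addChar (n * θ))
      (∑ n ∈ Finset.Ioc 0 M,
        ((m₁ * l₁ * (ζ : ArithmeticFunction ℝ)) n : ℂ) * addChar (n * θ))
  have t3 := norm_add_le (∑ n ∈ Finset.Ioc 0 M, (l₁ n : ℂ) * addChar (n * θ))
      (∑ n ∈ Finset.Ioc 0 M, ((m₁ * log) n : ℂ) * addChar (n * θ))
  linarith

end Vaughan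

/-! ### Residue classes -/

theorem addChar_eq_one_iff {x : ℝ} : addChar x = 1 ↔ ∃ n : ℤ, x = n := by
  constructor
  · intro h
    have h1 := distNearestInt_le_norm_addChar_sub_one x
    rw [h, sub_self, norm_zero] at h1
    have h2 : distNearestInt x = 0 := le_antisymm (by linarith) (distNearestInt_nonneg x)
    exact ⟨round x, sub_eq_zero.mp (abs_eq_zero.mp h2)⟩
  · rintro ⟨n, rfl⟩
    exact addChar_int n

theorem sum_addChar_div_eq {q : ℕ} (hq : 1 ≤ q) (m a : ℕ) :
    ∑ b ∈ Finset.range q, addChar (b * (((m : ℝ) - a) / q)) =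
      if m ≡ a [MOD q] then (q : ℂ) else 0 := by
  have hq' : (q : ℝ) ≠ 0 := by positivity
  simp only [addChar_nat_mul]
  have hiff : addChar (((m : ℝ) - a) / q) = 1 ↔ m ≡ a [MOD q] := by
    rw [addChar_eq_one_iff, Nat.ModEq.comm, Nat.modEq_iff_dvd]
    constructor
    · rintro ⟨n, hn⟩
      refine ⟨n, ?_⟩
      rw [div_eq_iff hq'] at hn
      rw [mul_comm]
      exact_mod_cast hn
    · rintro ⟨n, hn⟩
      refine ⟨n, ?_⟩
      rw [div_eq_iff hq', mul_comm]
      exact_mod_cast hn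
  split_ifs with h
  · rw [hiff.mpr h]
    simp
  · have hne : addChar (((m : ℝ) - a) / q) ≠ 1 := fun h1 => h (hiff.mp h1)
    have hpow : addChar (((m : ℝ) - a) / q) ^ q = 1 := by
      rw [← addChar_nat_mul, mul_div_cancel₀ _ hq']
      exact_mod_cast addChar_int ((m : ℤ) - a)
    rw [geom_sum_eq hne, hpow, sub_self, zero_div]

/-- Restricting an exponential sum to a residue class modulo `q` averages its shifts by the
fractions `b / q`. -/
theorem norm_sum_modEq_mul_addChar_le {q : ℕ} (hq : 1 ≤ q) (a M : ℕ) (w : ℕ → ℝ) {θ E : ℝ}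
    (hE : ∀ b : ℕ, ‖∑ m ∈ Finset.Ioc 0 M, (w m : ℂ) * addChar (m * (θ + b / q))‖ ≤ E) :
    ‖∑ m ∈ Finset.Ioc 0 M, ((if m ≡ a [MOD q] then w m else 0 : ℝ) : ℂ) * addChar (m * θ)‖ ≤
      E := by
  have hq' : (0 : ℝ) < q := by exact_mod_cast hq
  have hqC : (q : ℂ) ≠ 0 := by exact_mod_cast hq'.ne'
  have h1 : (q : ℂ) * ∑ m ∈ Finset.Ioc 0 M,
      ((if m ≡ a [MOD q] then w m else 0 : ℝ) : ℂ) * addChar (m * θ) =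
      ∑ b ∈ Finset.range q, addChar (-(b * (a / q))) *
        ∑ m ∈ Finset.Ioc 0 M, (w m : ℂ) * addChar (m * (θ + b / q)) := by
    simp only [Finset.mul_sum]
    rw [Finset.sum_comm]
    refine Finset.sum_congr rfl fun m _ => ?_
    have h2 : ∀ b : ℕ, addChar (-(b * (a / q))) * ((w m : ℂ) * addChar (m * (θ + b / q))) =
        (w m : ℂ) * addChar (m * θ) * addChar (b * (((m : ℝ) - a) / q)) := by
      intro b
      rw [mul_left_comm, ← addChar_add, mul_assoc, ← addChar_add]
      congr 2
      ring
    simp only [h2]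
    rw [← Finset.mul_sum, sum_addChar_div_eq hq]
    split_ifs
    · ring
    · simp
  have h3 : (q : ℝ) * ‖∑ m ∈ Finset.Ioc 0 M,
      ((if m ≡ a [MOD q] then w m else 0 : ℝ) : ℂ) * addChar (m * θ)‖ ≤ q * E := by
    have h4 := congrArg norm h1
    rw [norm_mul, Complex.norm_natCast] at h4
    rw [h4]
    refine (norm_sum_le _ _).trans ?_
    refine (Finset.sum_le_sum fun b _ => ?_).trans_eq (b := ∑ b ∈ Finset.range q, E) (by simp)
    rw [norm_mul, norm_addChar, one_mul]
    exact hE b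
  exact le_of_mul_le_mul_left h3 hq'

/-! ### Trigonometric approximation of the fractional part -/

theorem sum_Ioc_inv_sq_le_two (K : ℕ) : ∑ k ∈ Finset.Ioc 0 K, ((k : ℝ) ^ 2)⁻¹ ≤ 2 := by
  rcases Nat.eq_zero_or_pos K with rfl | hK
  · simp
  · have h1 := sum_Ioc_inv_sq_le_sub (α := ℝ) one_ne_zero hK
    have h2 : Finset.Ioc 0 K = insert 1 (Finset.Ioc 1 K) := by
      ext n
      simp only [Finset.mem_Ioc, Finset.mem_insert]
      omega
    rw [h2, Finset.sum_insert (by simp)]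
    have h3 : (0 : ℝ) ≤ (K : ℝ)⁻¹ := by positivity
    norm_num at h1 ⊢
    linarith

/-- The Fourier series of the second Bernoulli function, with the tail beyond `K` estimated. -/
theorem abs_bernoulli_two_sub_sum_le {K : ℕ} (hK : 1 ≤ K) (x : ℝ) :
    |(Int.fract x ^ 2 - Int.fract x + 6⁻¹) -
      ∑ k ∈ Finset.Ioc 0 K, (Real.pi ^ 2 * (k : ℝ) ^ 2)⁻¹ * Real.cos (2 * Real.pi * (k * x))| ≤
      (K : ℝ)⁻¹ := by
  set u : ℕ → ℝ := fun k => (Real.pi ^ 2 * (k : ℝ) ^ 2)⁻¹ * Real.cos (2 * Real.pi * (k * x)) with hu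
  have hpi : 1 ≤ Real.pi ^ 2 := one_le_pow₀ (by linarith [Real.pi_gt_three])
  have hsum : HasSum u (Int.fract x ^ 2 - Int.fract x + 6⁻¹) := by
    have h1 := hasSum_one_div_nat_pow_mul_cos one_ne_zero
      (x := Int.fract x) ⟨Int.fract_nonneg x, (Int.fract_lt_one x).le⟩
    have h2 : (Polynomial.map (algebraMap ℚ ℝ) (Polynomial.bernoulli (2 * 1))).eval (Int.fract x) =
        Int.fract x ^ 2 - Int.fract x + 6⁻¹ := bernoulliFun_two _
    rw [h2] at h1
    have h3 := h1.mul_left (Real.pi ^ 2)⁻¹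
    have hfun : u = fun k : ℕ => (Real.pi ^ 2)⁻¹ * (1 / (k : ℝ) ^ (2 * 1) *
        Real.cos (2 * Real.pi * k * Int.fract x)) := by
      funext k
      have hc : Real.cos (2 * Real.pi * (k * x)) = Real.cos (2 * Real.pi * k * Int.fract x) := by
        have := Real.cos_sub_int_mul_two_pi (2 * Real.pi * (k * x)) (k * ⌊x⌋)
        rw [← this]
        congr 1
        rw [Int.fract]
        push_cast
        ring
      simp only [hu]
      rw [hc, mul_inv]
      ring
    have hval : (Real.pi ^ 2)⁻¹ * ((-1 : ℝ) ^ (1 + 1) * (2 * Real.pi) ^ (2 * 1) / 2 /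
        ((2 * 1).factorial : ℕ) * (Int.fract x ^ 2 - Int.fract x + 6⁻¹)) =
        Int.fract x ^ 2 - Int.fract x + 6⁻¹ := by
      have := Real.pi_ne_zero
      norm_num [Nat.factorial]
      field_simp
    rw [hval] at h3
    rwa [hfun]
  have hlim := (hsum.tendsto_sum_nat.comp (Filter.tendsto_add_atTop_nat 1)).sub_const
    (∑ k ∈ Finset.Ioc 0 K, u k)
  refine le_of_tendsto hlim.abs ?_
  filter_upwards [Filter.eventually_ge_atTop K] with n hn
  have h1 : ∑ k ∈ Finset.range (n + 1), u k - ∑ k ∈ Finset.Ioc 0 K, u k =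
      ∑ k ∈ Finset.Ioc K n, u k := by
    have h2 : ∑ k ∈ Finset.range (n + 1), u k = ∑ k ∈ Finset.Ioc 0 n, u k := by
      symm
      refine Finset.sum_subset (fun k hk => ?_) fun k hk hk' => ?_
      · rw [Finset.mem_Ioc] at hk
        rw [Finset.mem_range]
        omega
      · rw [Finset.mem_range] at hk
        rw [Finset.mem_Ioc] at hk'
        have : k = 0 := by omega
        simp [hu, this]
    rw [h2, ← Finset.sum_Ioc_consecutive u (Nat.zero_le K) hn]
    ring
  rw [Function.comp_apply, h1]
  refine (Finset.abs_sum_le_sum_abs _ _).trans ?_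
  have h2 : ∀ k ∈ Finset.Ioc K n, |u k| ≤ ((k : ℝ) ^ 2)⁻¹ := by
    intro k hk
    have hk0 : (0 : ℝ) < k := by
      rw [Finset.mem_Ioc] at hk
      exact_mod_cast (by omega : 0 < k)
    simp only [hu]
    rw [abs_mul, abs_of_nonneg (by positivity)]
    calc _ ≤ (Real.pi ^ 2 * (k : ℝ) ^ 2)⁻¹ * 1 := by gcongr; exact Real.abs_cos_le_one _
      _ ≤ _ := by
        rw [mul_one]
        gcongr
        nlinarith [sq_nonneg (k : ℝ)]
  refine (Finset.sum_le_sum h2).trans ?_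
  have h3 := sum_Ioc_inv_sq_le_sub (α := ℝ) (k := K) (n := n) (by omega) hn
  have h4 : (0 : ℝ) ≤ (n : ℝ)⁻¹ := by positivity
  linarith

/-- A trigonometric polynomial of degree `K` close to `{x} - 1/2`: the truncated Fourier series of
the mean of `{x} - 1/2` over an interval of length `Δ`. -/
noncomputable def sawtoothPoly (K : ℕ) (Δ x : ℝ) : ℝ :=
  ∑ k ∈ Finset.Ioc 0 K, (2 * Δ * (Real.pi ^ 2 * (k : ℝ) ^ 2))⁻¹ *
    (Real.cos (2 * Real.pi * (k * (x + Δ))) - Real.cos (2 * Real.pi * (k * x)))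

theorem abs_fract_sub_smooth_le {Δ : ℝ} (hΔ : 0 < Δ) (hΔ1 : Δ ≤ 1) (x : ℝ) :
    |Int.fract x - 1 / 2 - ((Int.fract (x + Δ) ^ 2 - Int.fract (x + Δ) + 6⁻¹) -
      (Int.fract x ^ 2 - Int.fract x + 6⁻¹)) / (2 * Δ)| ≤
      Δ / 2 + if 1 - Δ ≤ Int.fract x then 1 else 0 := by
  have h0 := Int.fract_nonneg x
  have h1 := Int.fract_lt_one x
  set y := Int.fract x with hy
  split_ifs with h
  · have h2 : Int.fract (x + Δ) = y + Δ - 1 := by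
      rw [Int.fract_eq_iff]
      exact ⟨by linarith, by linarith, ⌊x⌋ + 1, by rw [hy, Int.fract]; push_cast; ring⟩
    rw [h2]
    have h3 : ((y + Δ - 1) ^ 2 - (y + Δ - 1) + 6⁻¹ - (y ^ 2 - y + 6⁻¹)) / (2 * Δ) =
        y + Δ / 2 - 1 / 2 - (y + Δ - 1) / Δ := by
      field_simp
      ring
    rw [h3]
    have h4 : 0 ≤ (y + Δ - 1) / Δ := div_nonneg (by linarith) hΔ.le
    have h5 : (y + Δ - 1) / Δ ≤ 1 := by rw [div_le_one hΔ]; linarith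
    rw [abs_le]
    constructor <;> linarith
  · have h2 : Int.fract (x + Δ) = y + Δ := by
      rw [Int.fract_eq_iff]
      exact ⟨by linarith, by linarith, ⌊x⌋, by rw [hy, Int.fract]; ring⟩
    rw [h2]
    have h3 : ((y + Δ) ^ 2 - (y + Δ) + 6⁻¹ - (y ^ 2 - y + 6⁻¹)) / (2 * Δ) =
        y + Δ / 2 - 1 / 2 := by
      field_simp
      ring
    rw [h3, abs_le]
    constructor <;> linarith

theorem abs_fract_sub_sawtoothPoly_le {K : ℕ} (hK : 1 ≤ K) {Δ : ℝ} (hΔ : 0 < Δ) (hΔ1 : Δ ≤ 1)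
    (x : ℝ) :
    |Int.fract x - 1 / 2 - sawtoothPoly K Δ x| ≤
      Δ / 2 + (Δ * K)⁻¹ + if 1 - Δ ≤ Int.fract x then 1 else 0 := by
  have h1 := abs_bernoulli_two_sub_sum_le hK (x + Δ)
  have h2 := abs_bernoulli_two_sub_sum_le hK x
  have h3 := abs_fract_sub_smooth_le hΔ hΔ1 x
  set b₁ := Int.fract (x + Δ) ^ 2 - Int.fract (x + Δ) + 6⁻¹ with hb₁
  set b₂ := Int.fract x ^ 2 - Int.fract x + 6⁻¹ with hb₂
  set s₁ := ∑ k ∈ Finset.Ioc 0 K, (Real.pi ^ 2 * (k : ℝ) ^ 2)⁻¹ *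
    Real.cos (2 * Real.pi * (k * (x + Δ))) with hs₁
  set s₂ := ∑ k ∈ Finset.Ioc 0 K, (Real.pi ^ 2 * (k : ℝ) ^ 2)⁻¹ *
    Real.cos (2 * Real.pi * (k * x)) with hs₂
  have h4 : sawtoothPoly K Δ x = (s₁ - s₂) / (2 * Δ) := by
    rw [hs₁, hs₂, ← Finset.sum_sub_distrib, Finset.sum_div, sawtoothPoly]
    refine Finset.sum_congr rfl fun k _ => ?_
    rw [mul_inv (2 * Δ)]
    ring
  have h5 : Int.fract x - 1 / 2 - sawtoothPoly K Δ x =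
      (Int.fract x - 1 / 2 - (b₁ - b₂) / (2 * Δ)) + ((b₁ - s₁) - (b₂ - s₂)) / (2 * Δ) := by
    rw [h4]
    ring
  have h6 : |((b₁ - s₁) - (b₂ - s₂)) / (2 * Δ)| ≤ (Δ * K)⁻¹ := by
    rw [abs_div, abs_of_pos (by positivity : 0 < 2 * Δ), div_le_iff₀ (by positivity)]
    have h7 := abs_sub (b₁ - s₁) (b₂ - s₂)
    have h8 : (Δ * K)⁻¹ * (2 * Δ) = (K : ℝ)⁻¹ + (K : ℝ)⁻¹ := by
      have : (K : ℝ) ≠ 0 := by positivity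
      field_simp
      norm_num
    rw [h8]
    linarith
  rw [h5]
  refine (abs_add_le _ _).trans ?_
  linarith

theorem abs_sum_mul_sawtoothPoly_le {M K : ℕ} {γ Δ E : ℝ} (hΔ : 0 < Δ) {w : ℕ → ℝ}
    (hE : ∀ k : ℕ, 1 ≤ k → k ≤ K →
      ‖∑ m ∈ Finset.Ioc 0 M, (w m : ℂ) * addChar (m * (k * γ))‖ ≤ E) (hE0 : 0 ≤ E) (y : ℝ) :
    |∑ m ∈ Finset.Ioc 0 M, w m * sawtoothPoly K Δ (y - m * γ)| ≤ 2 * E / Δ := by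
  have hcos : ∀ k : ℕ, 1 ≤ k → k ≤ K → ∀ z : ℝ,
      |∑ m ∈ Finset.Ioc 0 M, w m * Real.cos (2 * Real.pi * (k * (z - m * γ)))| ≤ E := by
    intro k h1 h2 z
    have h3 : ∑ m ∈ Finset.Ioc 0 M, w m * Real.cos (2 * Real.pi * (k * (z - m * γ))) =
        (addChar (-(k * z)) * ∑ m ∈ Finset.Ioc 0 M, (w m : ℂ) * addChar (m * (k * γ))).re := by
      rw [Finset.mul_sum, Complex.re_sum]
      refine Finset.sum_congr rfl fun m _ => ?_
      rw [mul_left_comm (addChar _), ← addChar_add, Complex.re_ofReal_mul, re_addChar,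
        ← Real.cos_neg]
      congr 2
      ring
    rw [h3]
    refine (Complex.abs_re_le_norm _).trans ?_
    rw [norm_mul, norm_addChar, one_mul]
    exact hE k h1 h2
  have hpi : 1 ≤ Real.pi ^ 2 := one_le_pow₀ (by linarith [Real.pi_gt_three])
  have h1 : ∑ m ∈ Finset.Ioc 0 M, w m * sawtoothPoly K Δ (y - m * γ) =
      ∑ k ∈ Finset.Ioc 0 K, (2 * Δ * (Real.pi ^ 2 * (k : ℝ) ^ 2))⁻¹ *
        (∑ m ∈ Finset.Ioc 0 M, w m * Real.cos (2 * Real.pi * (k * (y + Δ - m * γ))) -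
          ∑ m ∈ Finset.Ioc 0 M, w m * Real.cos (2 * Real.pi * (k * (y - m * γ)))) := by
    simp only [sawtoothPoly, Finset.mul_sum]
    rw [Finset.sum_comm]
    refine Finset.sum_congr rfl fun k _ => ?_
    rw [← Finset.sum_sub_distrib, Finset.mul_sum]
    refine Finset.sum_congr rfl fun m _ => ?_
    rw [show y + Δ - m * γ = y - m * γ + Δ by ring]
    ring
  rw [h1]
  refine (Finset.abs_sum_le_sum_abs _ _).trans ?_
  have h2 : ∀ k ∈ Finset.Ioc 0 K, |(2 * Δ * (Real.pi ^ 2 * (k : ℝ) ^ 2))⁻¹ *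
        (∑ m ∈ Finset.Ioc 0 M, w m * Real.cos (2 * Real.pi * (k * (y + Δ - m * γ))) -
          ∑ m ∈ Finset.Ioc 0 M, w m * Real.cos (2 * Real.pi * (k * (y - m * γ))))| ≤
        E / Δ * ((k : ℝ) ^ 2)⁻¹ := by
    intro k hk
    rw [Finset.mem_Ioc] at hk
    have hk0 : (0 : ℝ) < k := by exact_mod_cast hk.1
    have h3 := hcos k hk.1 hk.2 (y + Δ)
    have h4 := hcos k hk.1 hk.2 y
    rw [abs_mul, abs_of_nonneg (by positivity)]
    calc _ ≤ (2 * Δ * (1 * (k : ℝ) ^ 2))⁻¹ * (E + E) := by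
          gcongr
          exact (abs_sub _ _).trans (add_le_add h3 h4)
      _ = _ := by field_simp; ring
  refine (Finset.sum_le_sum h2).trans ?_
  rw [← Finset.mul_sum]
  calc _ ≤ E / Δ * 2 := by gcongr; exact sum_Ioc_inv_sq_le_two K
    _ = _ := by ring

/-- A weighted sum of `{y - mγ} - 1/2` is small if the weighted exponential sums with frequencies
`kγ` are; the points `y - mγ` at which the approximation by `sawtoothPoly` fails are sparse. -/
theorem abs_sum_mul_fract_sub_half_le {M K L : ℕ} (hK : 1 ≤ K) (hL : 1 ≤ L) {γ Δ E ℓ : ℝ}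
    (hΔ : 0 < Δ) (hΔ1 : Δ ≤ 1) (hγ : ∀ h : ℕ, 1 ≤ h → h < L → 4 * Δ ≤ distNearestInt (h * γ))
    {w : ℕ → ℝ} (hw0 : ∀ m, 0 ≤ w m) (hwℓ : ∀ m ≤ M, w m ≤ ℓ)
    (hE : ∀ k : ℕ, 1 ≤ k → k ≤ K →
      ‖∑ m ∈ Finset.Ioc 0 M, (w m : ℂ) * addChar (m * (k * γ))‖ ≤ E) (hE0 : 0 ≤ E) (y : ℝ) :
    |∑ m ∈ Finset.Ioc 0 M, w m * (Int.fract (y - m * γ) - 1 / 2)| ≤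
      2 * E / Δ + ℓ * (M * (Δ / 2 + (Δ * K)⁻¹) + (M / L + 1)) := by
  have hℓ : 0 ≤ ℓ := (hw0 0).trans (hwℓ 0 (Nat.zero_le M))
  have h1 : ∑ m ∈ Finset.Ioc 0 M, w m * (Int.fract (y - m * γ) - 1 / 2) =
      ∑ m ∈ Finset.Ioc 0 M, w m * sawtoothPoly K Δ (y - m * γ) +
      ∑ m ∈ Finset.Ioc 0 M,
        w m * (Int.fract (y - m * γ) - 1 / 2 - sawtoothPoly K Δ (y - m * γ)) := by
    rw [← Finset.sum_add_distrib]
    exact Finset.sum_congr rfl fun m _ => by ring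
  have h2 : |∑ m ∈ Finset.Ioc 0 M,
      w m * (Int.fract (y - m * γ) - 1 / 2 - sawtoothPoly K Δ (y - m * γ))| ≤
      ℓ * (M * (Δ / 2 + (Δ * K)⁻¹) + (M / L + 1)) := by
    refine (Finset.abs_sum_le_sum_abs _ _).trans ?_
    have h3 : ∀ m ∈ Finset.Ioc 0 M,
        |w m * (Int.fract (y - m * γ) - 1 / 2 - sawtoothPoly K Δ (y - m * γ))| ≤
        ℓ * (Δ / 2 + (Δ * K)⁻¹ + if 1 - Δ ≤ Int.fract (y - m * γ) then 1 else 0) := by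
      intro m hm
      rw [abs_mul, abs_of_nonneg (hw0 m)]
      exact mul_le_mul (hwℓ m (Finset.mem_Ioc.mp hm).2)
        (abs_fract_sub_sawtoothPoly_le hK hΔ hΔ1 _) (abs_nonneg _) hℓ
    refine (Finset.sum_le_sum h3).trans ?_
    rw [← Finset.mul_sum, Finset.sum_add_distrib, ← Finset.sum_filter, Finset.sum_const,
      Finset.sum_const, nsmul_eq_mul, nsmul_eq_mul, mul_one, Nat.card_Ioc, Nat.sub_zero]
    gcongr
    refine card_filter_dist_lt_le (θ := γ) (η := 2 * Δ) hL
      (fun h h1 h2 => by linarith [hγ h h1 h2]) y M _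
      (fun m hm => (Finset.mem_Ioc.mp (Finset.mem_filter.mp hm).1).2) fun m hm => ?_
    have h4 := (Finset.mem_filter.mp hm).2
    have h5 := distNearestInt_le_abs_sub (y - m * γ) (⌊y - m * γ⌋ + 1)
    have h6 : y - m * γ - ((⌊y - m * γ⌋ + 1 : ℤ) : ℝ) = -(1 - Int.fract (y - m * γ)) := by
      rw [Int.fract]
      push_cast
      ring
    rw [h6, abs_neg, abs_of_nonneg (by linarith [Int.fract_lt_one (y - m * γ)])] at h5
    linarith
  rw [h1]
  exact (abs_add_le _ _).trans (add_le_add (abs_sum_mul_sawtoothPoly_le hΔ hE hE0 y) h2)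

/-! ### Counting the terms of a Beatty sequence -/

/-- The von Mangoldt function restricted to the residue class of `a` modulo `q`. -/
noncomputable def residueWeight (a q m : ℕ) : ℝ :=
  if m ≡ a [MOD q] then ArithmeticFunction.vonMangoldt m else 0

theorem residueWeight_zero (a q : ℕ) : residueWeight a q 0 = 0 := by simp [residueWeight]

theorem residueWeight_nonneg (a q m : ℕ) : 0 ≤ residueWeight a q m := by
  rw [residueWeight]
  split_ifs
  · exact ArithmeticFunction.vonMangoldt_nonneg
  · exact le_rfl

theorem residueWeight_le_log (a q m : ℕ) : residueWeight a q m ≤ Real.log m := by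
  rw [residueWeight]
  split_ifs
  · exact ArithmeticFunction.vonMangoldt_le_log
  · exact Real.log_natCast_nonneg m

theorem ite_vonMangoldtInt_eq (a q : ℕ) (k : ℤ) :
    (if k ≡ (a : ℤ) [ZMOD (q : ℤ)] then vonMangoldtInt k else 0) = residueWeight a q k.toNat := by
  rcases le_or_gt k 0 with hk | hk
  · rw [vonMangoldtInt, Int.toNat_of_nonpos hk, residueWeight_zero]
    simp
  · lift k to ℕ using hk.le
    rw [vonMangoldtInt, residueWeight, Int.toNat_natCast]
    simp only [Int.natCast_modEq_iff]

theorem beattySum_eq_sum (α β : ℝ) (a q N : ℕ) :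
    beattySum α β a q N = ∑ n ∈ Finset.Icc 1 N, residueWeight a q ⌊α * n + β⌋.toNat := by
  rw [beattySum, Finset.sum_filter]
  exact Finset.sum_congr rfl fun n _ => ite_vonMangoldtInt_eq a q _

theorem progressionSum_eq_sum (a q : ℕ) (M : ℤ) :
    progressionSum a q M = ∑ m ∈ Finset.Ioc 0 M.toNat, residueWeight a q m := by
  rw [progressionSum, Finset.sum_filter]
  refine Finset.sum_bij' (fun k _ => k.toNat) (fun m _ => (m : ℤ)) ?_ ?_ ?_ ?_ ?_
  · intro k hk
    rw [Finset.mem_Icc] at hk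
    rw [Finset.mem_Ioc]
    omega
  · intro m hm
    rw [Finset.mem_Ioc] at hm
    rw [Finset.mem_Icc]
    omega
  · intro k hk
    rw [Finset.mem_Icc] at hk
    omega
  · intro m _
    simp
  · intro k _
    exact ite_vonMangoldtInt_eq a q k

/-- The number of integers `n` with `⌊αn + β⌋ = m`, where `γ = α⁻¹`, in terms of fractional
parts. -/
noncomputable def beattyMultiplicity (γ β : ℝ) (m : ℕ) : ℝ :=
  γ + Int.fract (γ * (β - 1) - m * γ) - Int.fract (γ * β - m * γ)

theorem beattyMultiplicity_eq_card (γ β : ℝ) (hγ : 0 < γ) (m : ℕ) :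
    beattyMultiplicity γ β m = ((Finset.Ico ⌈γ * (m - β)⌉ ⌈γ * (m + 1 - β)⌉).card : ℝ) := by
  have hle : ⌈γ * (m - β)⌉ ≤ ⌈γ * (m + 1 - β)⌉ := Int.ceil_le_ceil (by gcongr; linarith)
  have h1 : ⌈γ * (m - β)⌉ = -⌊γ * β - m * γ⌋ := by
    rw [← Int.ceil_neg]
    congr 1
    ring
  have h2 : ⌈γ * (m + 1 - β)⌉ = -⌊γ * (β - 1) - m * γ⌋ := by
    rw [← Int.ceil_neg]
    congr 1
    ring
  have h3 : (((Finset.Ico ⌈γ * (m - β)⌉ ⌈γ * (m + 1 - β)⌉).card : ℤ) : ℝ) =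
      ((⌈γ * (m + 1 - β)⌉ - ⌈γ * (m - β)⌉ : ℤ) : ℝ) := by
    rw [Int.card_Ico_of_le _ _ hle]
  rw [Int.cast_natCast] at h3
  rw [h3, h1, h2, beattyMultiplicity, Int.fract, Int.fract]
  push_cast
  ring

theorem mem_Ico_ceil_iff {α β : ℝ} (hα : 0 < α) (m : ℕ) (n : ℤ) :
    n ∈ Finset.Ico ⌈α⁻¹ * (m - β)⌉ ⌈α⁻¹ * (m + 1 - β)⌉ ↔ ⌊α * n + β⌋ = m := by
  rw [Finset.mem_Ico, Int.ceil_le, Int.lt_ceil, Int.floor_eq_iff, inv_mul_le_iff₀ hα,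
    lt_inv_mul_iff₀ hα]
  push_cast
  constructor <;> rintro ⟨h1, h2⟩ <;> constructor <;> linarith

/-- Replacing the exact number of `n ∈ [1, N]` with `⌊αn + β⌋ = m` by the number of all such
integers `n` changes only the values `m ≤ β` and the last value of the sequence. -/
theorem abs_card_sub_beattyMultiplicity_le {α β : ℝ} (hα : 0 < α) (N m : ℕ) :
    |(((Finset.Icc 1 N).filter fun n : ℕ => ⌊α * n + β⌋ = m).card : ℝ) -
      beattyMultiplicity α⁻¹ β m| ≤
      if (m : ℤ) ≤ ⌊β⌋ ∨ ⌊α * N + β⌋ ≤ m then α⁻¹ + 1 else 0 := by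
  have hγ : 0 < α⁻¹ := inv_pos.mpr hα
  set s := (Finset.Icc 1 N).filter fun n : ℕ => ⌊α * n + β⌋ = m with hs
  set I := Finset.Ico ⌈α⁻¹ * (m - β)⌉ ⌈α⁻¹ * (m + 1 - β)⌉ with hI
  have hsub : s.map Nat.castEmbedding ⊆ I := by
    intro k hk
    obtain ⟨n, hn, rfl⟩ := Finset.mem_map.mp hk
    rw [hI, mem_Ico_ceil_iff hα]
    simpa using (Finset.mem_filter.mp hn).2
  rw [beattyMultiplicity_eq_card _ _ hγ, ← hI]
  have hle : (s.card : ℝ) ≤ I.card := by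
    rw [← Finset.card_map (Nat.castEmbedding : ℕ ↪ ℤ)]
    exact_mod_cast Finset.card_le_card hsub
  split_ifs with h
  · have h1 : (I.card : ℝ) ≤ α⁻¹ + 1 := by
      rw [hI, ← beattyMultiplicity_eq_card _ _ hγ, beattyMultiplicity]
      linarith [Int.fract_nonneg (α⁻¹ * β - m * α⁻¹),
        Int.fract_lt_one (α⁻¹ * (β - 1) - m * α⁻¹)]
    rw [abs_le]
    have : (0 : ℝ) ≤ s.card := Nat.cast_nonneg _
    constructor <;> linarith
  · push Not at h
    have heq : s.map Nat.castEmbedding = I := by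
      refine Finset.Subset.antisymm hsub fun k hk => ?_
      rw [hI, mem_Ico_ceil_iff hα] at hk
      have hk1 : 1 ≤ k := by
        by_contra! hlt
        have h1 : (k : ℝ) ≤ 0 := by exact_mod_cast (by omega : k ≤ 0)
        have h2 : ⌊α * k + β⌋ ≤ ⌊β⌋ := Int.floor_le_floor (by nlinarith)
        omega
      have hkN : k ≤ N := by
        by_contra! hlt
        have h1 : (N : ℝ) ≤ k := by exact_mod_cast hlt.le
        have h2 : ⌊α * N + β⌋ ≤ ⌊α * k + β⌋ := Int.floor_le_floor (by nlinarith)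
        omega
      lift k to ℕ using by omega
      refine Finset.mem_map.mpr ⟨k, Finset.mem_filter.mpr ⟨Finset.mem_Icc.mpr ⟨?_, ?_⟩, ?_⟩, rfl⟩
      · exact_mod_cast hk1
      · exact_mod_cast hkN
      · simpa using hk
    rw [← heq, Finset.card_map, sub_self, abs_zero]

/-- The discrepancy between the two sums of the theorem is a sum of sawtooth functions, up to
boundary terms. -/
theorem abs_beattySum_sub_le {α β ℓ : ℝ} (hα : 0 < α) (a q N : ℕ)
    (hℓ : Real.log (⌊α * N + β⌋.toNat : ℕ) ≤ ℓ) :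
    |beattySum α β a q N - α⁻¹ * progressionSum a q ⌊α * N + β⌋| ≤
      |∑ m ∈ Finset.Ioc 0 ⌊α * N + β⌋.toNat,
        residueWeight a q m * (Int.fract (α⁻¹ * (β - 1) - m * α⁻¹) - 1 / 2)| +
      |∑ m ∈ Finset.Ioc 0 ⌊α * N + β⌋.toNat,
        residueWeight a q m * (Int.fract (α⁻¹ * β - m * α⁻¹) - 1 / 2)| +
      ℓ * ((α⁻¹ + 1) * (|β| + 1)) := by
  set M := ⌊α * N + β⌋.toNat with hM
  set w := residueWeight a q with hw
  set r : ℕ → ℝ := fun m => (((Finset.Icc 1 N).filter fun n : ℕ => ⌊α * n + β⌋ = m).card : ℝ)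
    with hr
  have hγ : 0 < α⁻¹ := inv_pos.mpr hα
  have hℓ0 : 0 ≤ ℓ := (Real.log_natCast_nonneg M).trans hℓ
  have h1 : beattySum α β a q N = ∑ m ∈ Finset.Ioc 0 M, w m * r m := by
    rw [beattySum_eq_sum]
    have hmaps : ∀ n ∈ Finset.Icc 1 N, ⌊α * n + β⌋.toNat ∈ Finset.Icc 0 M := by
      intro n hn
      rw [Finset.mem_Icc] at hn ⊢
      refine ⟨Nat.zero_le _, Int.toNat_le_toNat (Int.floor_le_floor ?_)⟩
      have : (n : ℝ) ≤ N := by exact_mod_cast hn.2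
      gcongr
    rw [← Finset.sum_fiberwise_of_maps_to hmaps]
    have hsub : Finset.Ioc 0 M ⊆ Finset.Icc 0 M := Finset.Ioc_subset_Icc_self
    rw [← Finset.sum_subset hsub]
    · refine Finset.sum_congr rfl fun m hm => ?_
      rw [Finset.mem_Ioc] at hm
      have h2 : (Finset.Icc 1 N).filter (fun n : ℕ => ⌊α * n + β⌋.toNat = m) =
          (Finset.Icc 1 N).filter (fun n : ℕ => ⌊α * n + β⌋ = m) := by
        refine Finset.filter_congr fun n _ => ?_
        omega
      rw [h2, Finset.sum_congr rfl (g := fun _ => w m), Finset.sum_const, nsmul_eq_mul, mul_comm]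
      intro n hn
      rw [(Finset.mem_filter.mp hn).2, Int.toNat_natCast]
    · intro m hm hm'
      refine Finset.sum_eq_zero fun n hn => ?_
      rw [Finset.mem_Icc] at hm
      rw [Finset.mem_Ioc] at hm'
      rw [(Finset.mem_filter.mp hn).2, show m = 0 by omega, residueWeight_zero]
  rw [h1, progressionSum_eq_sum, Finset.mul_sum, ← Finset.sum_sub_distrib]
  have h2 : ∑ m ∈ Finset.Ioc 0 M, (w m * r m - α⁻¹ * w m) =
      ∑ m ∈ Finset.Ioc 0 M, w m * (Int.fract (α⁻¹ * (β - 1) - m * α⁻¹) - 1 / 2) -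
      ∑ m ∈ Finset.Ioc 0 M, w m * (Int.fract (α⁻¹ * β - m * α⁻¹) - 1 / 2) +
      ∑ m ∈ Finset.Ioc 0 M, w m * (r m - beattyMultiplicity α⁻¹ β m) := by
    rw [← Finset.sum_sub_distrib, ← Finset.sum_add_distrib]
    refine Finset.sum_congr rfl fun m _ => ?_
    rw [beattyMultiplicity]
    ring
  have h3 : |∑ m ∈ Finset.Ioc 0 M, w m * (r m - beattyMultiplicity α⁻¹ β m)| ≤
      ℓ * ((α⁻¹ + 1) * (|β| + 1)) := by
    refine (Finset.abs_sum_le_sum_abs _ _).trans ?_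
    have h4 : ∀ m ∈ Finset.Ioc 0 M, |w m * (r m - beattyMultiplicity α⁻¹ β m)| ≤
        if (m : ℤ) ≤ ⌊β⌋ ∨ ⌊α * N + β⌋ ≤ m then ℓ * (α⁻¹ + 1) else 0 := by
      intro m hm
      have h5 := abs_card_sub_beattyMultiplicity_le (β := β) hα N m
      rw [abs_mul, abs_of_nonneg (residueWeight_nonneg a q m)]
      have h6 : w m ≤ ℓ := (residueWeight_le_log a q m).trans
        ((log_natCast_monotone (Finset.mem_Ioc.mp hm).2).trans hℓ)
      refine (mul_le_mul h6 h5 (abs_nonneg _) hℓ0).trans (le_of_eq ?_)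
      split_ifs <;> ring
    refine (Finset.sum_le_sum h4).trans ?_
    rw [← Finset.sum_filter, Finset.sum_const, nsmul_eq_mul]
    have h5 : (((Finset.Ioc 0 M).filter fun m : ℕ =>
        (m : ℤ) ≤ ⌊β⌋ ∨ ⌊α * N + β⌋ ≤ m).card : ℝ) ≤ |β| + 1 := by
      have hsub : ((Finset.Ioc 0 M).filter fun m : ℕ =>
          (m : ℤ) ≤ ⌊β⌋ ∨ ⌊α * N + β⌋ ≤ m) ⊆ insert M (Finset.Ioc 0 ⌊β⌋.toNat) := by
        intro m hm
        rw [Finset.mem_filter, Finset.mem_Ioc] at hm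
        rw [Finset.mem_insert, Finset.mem_Ioc]
        omega
      have h6 := (Finset.card_le_card hsub).trans (Finset.card_insert_le _ _)
      rw [Nat.card_Ioc, Nat.sub_zero] at h6
      have h7 : (⌊β⌋.toNat : ℝ) ≤ |β| := by
        rcases le_or_gt ⌊β⌋ 0 with hb | hb
        · rw [Int.toNat_of_nonpos hb]
          simp
        · have h8 : ((⌊β⌋.toNat : ℤ) : ℝ) = (⌊β⌋ : ℝ) := by rw [Int.toNat_of_nonneg hb.le]
          rw [Int.cast_natCast] at h8
          rw [h8]
          exact (Int.floor_le β).trans (le_abs_self β)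
      calc _ ≤ ((⌊β⌋.toNat + 1 : ℕ) : ℝ) := by exact_mod_cast h6
        _ ≤ _ := by push_cast; linarith
    calc _ ≤ (|β| + 1) * (ℓ * (α⁻¹ + 1)) := by gcongr
      _ = _ := by ring
  rw [h2]
  refine (abs_add_le _ _).trans (add_le_add ?_ h3)
  exact abs_sub _ _

/-! ### Choice of parameters -/

/-- Exponential sums over primes with frequency `kγ + b/q`, where `k` and `q` are bounded by small
powers of the parameter `P`, save a power of `P`. -/
theorem exists_norm_sum_vonMangoldt_le {γ c : ℝ} {A : ℕ} (hc : 0 < c)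
    (hγ : ∀ n : ℕ, 1 ≤ n → c ≤ (n : ℝ) ^ A * distNearestInt (γ * n)) :
    ∃ C : ℝ, 0 < C ∧ ∃ W : ℕ, ∀ (P M k q b : ℕ) (ℓ : ℝ), 1 ≤ P → 1 ≤ k → k ≤ P ^ (A + 2) →
      1 ≤ q → q ≤ P → 1 ≤ ℓ → Real.log M ≤ ℓ →
      ‖∑ m ∈ Finset.Ioc 0 M, (ArithmeticFunction.vonMangoldt m : ℂ) *
        addChar (m * (k * γ + b / q))‖ ≤
        C * ℓ * (P : ℝ) ^ W + 4 * ℓ ^ 2 * M / (P : ℝ) ^ (A + 2) := by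
  set C₀ : ℕ := ⌈2 / c⌉₊ with hC₀
  have hC₀pos : 1 ≤ C₀ := Nat.one_le_iff_ne_zero.mpr (Nat.ceil_pos.mpr (by positivity)).ne'
  have hC₀c : 2 / c ≤ C₀ := Nat.le_ceil _
  set W : ℕ := (2 * A + 4) * ((2 * A + 4) * (A + 1)) with hW
  refine ⟨1 + 2 * ((C₀ : ℝ) ^ (A + 1) / c), by positivity, W, ?_⟩
  intro P M k q b ℓ hP hk hkP hq hqP hℓ hM
  set R : ℕ := P ^ (2 * A + 4) with hR
  have hR1 : 1 ≤ R := Nat.one_le_pow _ _ hP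
  have hR' : (1 : ℝ) ≤ R := by exact_mod_cast hR1
  have hR0 : (0 : ℝ) < R := by linarith
  have hP0 : (0 : ℝ) < P := by exact_mod_cast hP
  have hqR : (q : ℝ) ≤ R := by
    exact_mod_cast hqP.trans (by
      calc P = P ^ 1 := (pow_one P).symm
        _ ≤ R := Nat.pow_le_pow_right hP (by omega))
  have hqkR : (q : ℝ) * k ≤ R := by
    have : q * k ≤ R := by
      calc q * k ≤ P * P ^ (A + 2) := Nat.mul_le_mul hqP hkP
        _ = P ^ (A + 3) := by ring
        _ ≤ R := Nat.pow_le_pow_right hP (by omega)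
    exact_mod_cast this
  set θ : ℝ := k * γ + b / q with hθ
  have hlow : ∀ (h : ℕ) (H : ℝ), 1 ≤ h → (h : ℝ) ≤ H →
      c / ((R : ℝ) ^ (A + 1) * H ^ A) ≤ distNearestInt (h * θ) := by
    intro h H h1 hH
    have h0 : (0 : ℝ) < h := by exact_mod_cast h1
    have hH0 : 0 < H := h0.trans_le hH
    have h2 := le_distNearestInt_mul_add_div hγ hk hq b h1
    have h3 := distNearestInt_nonneg (h * θ)
    rw [div_le_iff₀ (by positivity)]
    calc c ≤ q * (q * h * k : ℝ) ^ A * distNearestInt (h * θ) := h2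
      _ = q * ((q * k : ℝ) ^ A * (h : ℝ) ^ A) * distNearestInt (h * θ) := by
        rw [← mul_pow]
        ring
      _ ≤ R * ((R : ℝ) ^ A * H ^ A) * distNearestInt (h * θ) := by gcongr
      _ = _ := by ring
  -- the bilinear range uses `h < R`, the linear one `h ≤ C₀ R ^ (2 A + 3)`
  set η : ℝ := c / (2 * (R : ℝ) ^ (2 * A + 1)) with hη
  set U : ℕ := C₀ * R ^ (2 * A + 2) with hU
  set η' : ℝ := c / ((R : ℝ) ^ (A + 1) * ((C₀ : ℝ) * (R : ℝ) ^ (2 * A + 3)) ^ A) with hη'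
  have hC₀0 : (0 : ℝ) < C₀ := by exact_mod_cast hC₀pos
  have hr2 : ((P : ℝ) ^ (A + 2)) ^ 2 = R := by
    rw [hR]
    push_cast
    ring
  have hmain := norm_sum_vonMangoldt_mul_addChar_le (M := M) (U := U) (V := R) (L := R)
    (θ := θ) (η := η) (η' := η') (r := (P : ℝ) ^ (A + 2)) (ℓ := ℓ)
    (Nat.mul_pos hC₀pos (pow_pos hR1 _)) (by positivity) (by positivity) (by positivity) hℓ hM
    hR1 hR1 hr2.le hr2.le
    (by
      rw [hr2, hU, hη]
      push_cast
      calc (R : ℝ) = 2 / c * (c / 2) * R := by field_simp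
        _ ≤ C₀ * (c / 2) * R := by gcongr
        _ = _ := by field_simp; ring)
    (by
      intro h h1 h2
      refine le_trans (le_of_eq ?_) (hlow h R h1 (by exact_mod_cast h2.le))
      rw [hη]
      field_simp
      ring)
    (by
      intro h h1 h2
      refine hlow h _ h1 ?_
      have : (h : ℝ) ≤ ((U * R : ℕ) : ℝ) := by exact_mod_cast h2
      refine this.trans (le_of_eq ?_)
      rw [hU]
      push_cast
      ring)
  refine hmain.trans ?_
  have hRW : (R : ℝ) ^ ((2 * A + 4) * (A + 1)) = (P : ℝ) ^ W := by
    rw [hR, hW]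
    push_cast
    rw [← pow_mul]
  have e1 : (R : ℝ) * ℓ ≤ ℓ * (P : ℝ) ^ W := by
    rw [← hRW, mul_comm]
    gcongr
    exact le_self_pow₀ hR' (by positivity)
  have e2 : (U : ℝ) * R * (ℓ * η'⁻¹) = (C₀ : ℝ) ^ (A + 1) / c * ℓ * (P : ℝ) ^ W := by
    rw [← hRW, hU, hη', inv_div]
    push_cast
    rw [mul_pow, ← pow_mul]
    field_simp
    ring
  rw [e2]
  have e3 : (1 + 2 * ((C₀ : ℝ) ^ (A + 1) / c)) * ℓ * (P : ℝ) ^ W =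
      ℓ * (P : ℝ) ^ W + 2 * ((C₀ : ℝ) ^ (A + 1) / c * ℓ * (P : ℝ) ^ W) := by ring
  rw [e3]
  gcongr

/-- The sawtooth sums over primes in a residue class save almost a factor `P`. -/
theorem exists_abs_sum_mul_fract_le {γ c : ℝ} {A : ℕ} (hc : 0 < c) (hc1 : c ≤ 1)
    (hγ : ∀ n : ℕ, 1 ≤ n → c ≤ (n : ℝ) ^ A * distNearestInt (γ * n)) :
    ∃ C : ℝ, 0 < C ∧ ∃ W : ℕ, ∀ (P M a q : ℕ) (ℓ y : ℝ), 1 ≤ P → 1 ≤ q → q ≤ P → 1 ≤ ℓ →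
      Real.log M ≤ ℓ →
      |∑ m ∈ Finset.Ioc 0 M, residueWeight a q m * (Int.fract (y - m * γ) - 1 / 2)| ≤
        C * ℓ ^ 2 * ((P : ℝ) ^ W + M / P) := by
  obtain ⟨C, hC, W, hE⟩ := exists_norm_sum_vonMangoldt_le hc hγ
  refine ⟨8 / c * (C + 4) + 6 / c, by positivity, W + A + 1, ?_⟩
  intro P M a q ℓ y hP hq hqP hℓ hM
  have hP1 : (1 : ℝ) ≤ P := by exact_mod_cast hP
  have hP0 : (0 : ℝ) < P := by linarith
  set Δ : ℝ := c / (4 * (P : ℝ) ^ (A + 1)) with hΔ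
  have hPA : (P : ℝ) ≤ (P : ℝ) ^ (A + 1) := le_self_pow₀ hP1 (by omega)
  have hΔ1 : Δ ≤ 1 := by
    rw [hΔ, div_le_one (by positivity)]
    linarith
  set E : ℝ := C * ℓ * (P : ℝ) ^ W + 4 * ℓ ^ 2 * M / (P : ℝ) ^ (A + 2) with hEdef
  have hmain := abs_sum_mul_fract_sub_half_le (M := M) (K := P ^ (A + 2)) (L := P) (γ := γ)
    (Δ := Δ) (E := E) (ℓ := ℓ) (w := residueWeight a q) (Nat.one_le_pow _ _ hP) hP (by positivity)
    hΔ1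
    (by
      intro h h1 h2
      have h3 := hγ h h1
      have h4 := distNearestInt_nonneg (h * γ)
      have h5 : (h : ℝ) ≤ P := by exact_mod_cast h2.le
      rw [mul_comm γ] at h3
      have h6 : 4 * Δ = c / (P : ℝ) ^ (A + 1) := by
        rw [hΔ]
        field_simp
      rw [h6, div_le_iff₀ (by positivity), mul_comm]
      refine h3.trans ?_
      gcongr
      calc (h : ℝ) ^ A ≤ (P : ℝ) ^ A := by gcongr
        _ ≤ (P : ℝ) ^ (A + 1) := pow_le_pow_right₀ hP1 (by omega))
    (residueWeight_nonneg a q)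
    (fun m hm => (residueWeight_le_log a q m).trans ((log_natCast_monotone hm).trans hM))
    (fun k h1 h2 => norm_sum_modEq_mul_addChar_le hq a M _
      fun b => hE P M k q b ℓ hP h1 h2 hq hqP hℓ hM)
    (by positivity) y
  refine hmain.trans ?_
  have hM0 : (0 : ℝ) ≤ M := Nat.cast_nonneg M
  have hℓ2 : ℓ ≤ ℓ ^ 2 := le_self_pow₀ hℓ (by norm_num)
  have hc' : 1 ≤ 1 / c := by rw [le_div_iff₀ hc]; linarith
  have hPW : (1 : ℝ) ≤ (P : ℝ) ^ (W + A + 1) := one_le_pow₀ hP1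
  have t1 : 2 * E / Δ ≤ 8 / c * (C + 4) * ℓ ^ 2 * ((P : ℝ) ^ (W + A + 1) + M / P) := by
    have : 2 * E / Δ = 8 / c * (C * ℓ * (P : ℝ) ^ (W + A + 1) + 4 * ℓ ^ 2 * (M / P)) := by
      rw [hEdef, hΔ]
      field_simp
      ring
    rw [this, mul_assoc (8 / c), mul_assoc (8 / c)]
    gcongr
    have h1 : C * ℓ * (P : ℝ) ^ (W + A + 1) ≤ C * ℓ ^ 2 * (P : ℝ) ^ (W + A + 1) := by gcongr
    have h2 : 0 ≤ C * ℓ ^ 2 * (M / P) := by positivity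
    have h3 : 0 ≤ 4 * ℓ ^ 2 * (P : ℝ) ^ (W + A + 1) := by positivity
    nlinarith
  have t2 : ℓ * (M * (Δ / 2 + (Δ * (P ^ (A + 2) : ℕ))⁻¹) + (M / P + 1)) ≤
      6 / c * ℓ ^ 2 * ((P : ℝ) ^ (W + A + 1) + M / P) := by
    have h1 : Δ / 2 ≤ 1 / c / P := by
      rw [hΔ, div_div, div_div, div_le_div_iff₀ (by positivity) (by positivity)]
      have : c * (c * P) ≤ 1 * (1 * (P : ℝ) ^ (A + 1)) := by gcongr
      have h2 : 0 < (P : ℝ) ^ (A + 1) := by positivity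
      linarith
    have h2 : (Δ * (P ^ (A + 2) : ℕ))⁻¹ = 4 / c / P := by
      rw [hΔ]
      push_cast
      field_simp
      ring
    have h3 : (M : ℝ) / P + 1 ≤ 1 / c * (M / P) + 1 / c * (P : ℝ) ^ (W + A + 1) := by
      have h4 : 0 ≤ (M : ℝ) / P := by positivity
      nlinarith
    rw [h2]
    have h5 : 0 ≤ 1 / c * (P : ℝ) ^ (W + A + 1) := by positivity
    calc _ ≤ ℓ ^ 2 * (M * (1 / c / P + 4 / c / P) +
          (1 / c * (M / P) + 1 / c * (P : ℝ) ^ (W + A + 1))) := by gcongr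
      _ ≤ ℓ ^ 2 * (6 * (1 / c) * (M / P) + 6 * (1 / c * (P : ℝ) ^ (W + A + 1))) := by
          gcongr ?_ * ?_
          have : (M : ℝ) * (1 / c / P + 4 / c / P) + 1 / c * (M / P) = 6 * (1 / c) * (M / P) := by
            field_simp
            norm_num
          linarith
      _ = _ := by ring
  linarith

theorem mainTheorem2 (α : ℝ) (hα : 0 < α) (hirr : Irrational α) (htype : IsOfFiniteType α) :
    ∃ κ : ℝ, 0 < κ ∧ ∀ β : ℝ, ∃ C : ℝ, ∀ N a q : ℕ, a < q → (q : ℝ) ≤ (N : ℝ) ^ κ →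
      Nat.Coprime a q →
        |beattySum α β a q N - α⁻¹ * progressionSum a q ⌊α * N + β⌋| ≤ C * (N : ℝ) ^ (1 - κ) := by
  obtain ⟨A, c₁, hc₁, hα₁⟩ := exists_le_distNearestInt_of_isOfFiniteType hirr htype
  obtain ⟨c₂, hc₂, hγ₂⟩ := exists_le_distNearestInt_inv hα hc₁ hα₁
  obtain ⟨C, hC, W, hsum⟩ := exists_abs_sum_mul_fract_le (lt_min hc₂ one_pos) (min_le_right c₂ 1)
    fun n hn => (min_le_left c₂ 1).trans (hγ₂ n hn)
  -- `P = ⌊N ^ ε⌋` with `ε W ≤ 1 / 2`; half of the saving `N ^ ε` is spent on logarithms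
  set ε : ℝ := 1 / (2 * (W + 1)) with hε
  have hε0 : 0 < ε := by positivity
  have hεW : ε * W ≤ 1 / 2 := by
    rw [hε, div_mul_eq_mul_div, div_le_div_iff₀ (by positivity) two_pos]
    linarith
  have hε1 : ε ≤ 1 / 2 := by
    rw [hε, div_le_div_iff₀ (by positivity) two_pos]
    have : (0 : ℝ) ≤ W := Nat.cast_nonneg W
    linarith
  refine ⟨ε / 2, by positivity, fun β => ?_⟩
  set B : ℝ := α + |β| + 1 with hB
  have hB1 : 1 ≤ B := by
    have := abs_nonneg β
    linarith
  set D : ℝ := 1 + Real.log B + 4 / ε with hD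
  have hlogB : 0 ≤ Real.log B := Real.log_nonneg hB1
  have hD1 : 1 ≤ D := by
    have : 0 ≤ 4 / ε := by positivity
    linarith
  set G : ℝ := (α⁻¹ + 1) * (|β| + 1) with hG
  have hG0 : 0 ≤ G := by positivity
  refine ⟨2 * (C * D ^ 2 * (1 + 2 * B)) + D * G, fun N a q haq hqN _ => ?_⟩
  have hq1 : 1 ≤ q := by omega
  have hN1 : 1 ≤ N := by
    rw [Nat.one_le_iff_ne_zero]
    rintro rfl
    rw [Nat.cast_zero, Real.zero_rpow (by positivity)] at hqN
    have : (1 : ℝ) ≤ q := by exact_mod_cast hq1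
    linarith
  set x : ℝ := (N : ℝ) with hx
  have hx1 : 1 ≤ x := Nat.one_le_cast.mpr hN1
  have hx0 : 0 < x := by linarith
  set P : ℕ := ⌊x ^ ε⌋₊ with hP
  have hxε : 1 ≤ x ^ ε := Real.one_le_rpow hx1 hε0.le
  have hP1 : 1 ≤ P := Nat.le_floor (by exact_mod_cast hxε)
  have hPle : (P : ℝ) ≤ x ^ ε := Nat.floor_le (by positivity)
  have hPge : x ^ ε ≤ 2 * P := by
    have h1 := Nat.lt_floor_add_one (x ^ ε)
    have h2 : (1 : ℝ) ≤ P := by exact_mod_cast hP1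
    linarith
  have hqP : q ≤ P := Nat.le_floor (hqN.trans (Real.rpow_le_rpow_of_exponent_le hx1 (by linarith)))
  set M : ℕ := ⌊α * x + β⌋.toNat with hM
  have hMB : (M : ℝ) ≤ B * x := by
    have hBx : α * x + β ≤ B * x := by
      have := le_abs_self β
      have := mul_le_mul_of_nonneg_left hx1 (abs_nonneg β)
      rw [hB]
      linarith
    rcases le_or_gt ⌊α * x + β⌋ 0 with h | h
    · rw [hM, Int.toNat_of_nonpos h, Nat.cast_zero]
      positivity
    · have h1 : ((M : ℤ) : ℝ) = (⌊α * x + β⌋ : ℝ) := by rw [hM, Int.toNat_of_nonneg h.le]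
      rw [Int.cast_natCast] at h1
      rw [h1]
      exact (Int.floor_le _).trans hBx
  set ℓ : ℝ := D * x ^ (ε / 4) with hℓ
  have hxε4 : 1 ≤ x ^ (ε / 4) := Real.one_le_rpow hx1 (by positivity)
  have hℓ1 : 1 ≤ ℓ := one_le_mul_of_one_le_of_one_le hD1 hxε4
  have hMℓ : Real.log M ≤ ℓ := by
    rcases Nat.eq_zero_or_pos M with h0 | h0
    · rw [h0, Nat.cast_zero, Real.log_zero]
      linarith
    · have h1 : Real.log M ≤ Real.log B + Real.log x := by
        rw [← Real.log_mul (by positivity) (by positivity)]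
        exact Real.log_le_log (by exact_mod_cast h0) hMB
      have h2 := Real.log_le_rpow_div hx0.le (by positivity : 0 < ε / 4)
      have h3 : x ^ (ε / 4) / (ε / 4) = 4 / ε * x ^ (ε / 4) := by field_simp
      rw [h3] at h2
      have h4 := mul_le_mul_of_nonneg_left hxε4 hlogB
      rw [hℓ, hD]
      linarith
  have hbound := abs_beattySum_sub_le (β := β) hα a q N hMℓ
  have hs₁ := hsum P M a q ℓ (α⁻¹ * (β - 1)) hP1 hq1 hqP hℓ1 hMℓ
  have hs₂ := hsum P M a q ℓ (α⁻¹ * β) hP1 hq1 hqP hℓ1 hMℓ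
  have hℓsq : ℓ ^ 2 = D ^ 2 * x ^ (ε / 2) := by
    rw [hℓ, mul_pow, ← Real.rpow_natCast (x ^ (ε / 4)), ← Real.rpow_mul hx0.le]
    congr 2
    push_cast
    ring
  have hPW : (P : ℝ) ^ W ≤ x ^ (1 - ε) := by
    calc (P : ℝ) ^ W ≤ (x ^ ε) ^ W := by gcongr
      _ = x ^ (ε * W) := by rw [Real.rpow_mul hx0.le, Real.rpow_natCast]
      _ ≤ _ := Real.rpow_le_rpow_of_exponent_le hx1 (by linarith)
  have hMP : (M : ℝ) / P ≤ 2 * B * x ^ (1 - ε) := by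
    have hP0 : (0 : ℝ) < P := by exact_mod_cast hP1
    rw [div_le_iff₀ hP0]
    calc (M : ℝ) ≤ B * (x ^ (1 - ε) * x ^ ε) := by
          rw [← Real.rpow_add hx0, sub_add_cancel, Real.rpow_one]
          exact hMB
      _ ≤ B * (x ^ (1 - ε) * (2 * P)) := by gcongr
      _ = _ := by ring
  have hmain : C * ℓ ^ 2 * ((P : ℝ) ^ W + M / P) ≤ C * D ^ 2 * (1 + 2 * B) * x ^ (1 - ε / 2) := by
    have hsplit : x ^ (1 - ε / 2) = x ^ (ε / 2) * x ^ (1 - ε) := by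
      rw [← Real.rpow_add hx0]
      congr 1
      ring
    rw [hℓsq, hsplit]
    calc _ ≤ C * (D ^ 2 * x ^ (ε / 2)) * (x ^ (1 - ε) + 2 * B * x ^ (1 - ε)) := by gcongr
      _ = _ := by ring
  have hedge : ℓ * G ≤ D * G * x ^ (1 - ε / 2) := by
    have h1 : x ^ (ε / 4) ≤ x ^ (1 - ε / 2) :=
      Real.rpow_le_rpow_of_exponent_le hx1 (by linarith)
    calc ℓ * G = D * G * x ^ (ε / 4) := by rw [hℓ]; ring
      _ ≤ _ := by gcongr
  calc _ ≤ _ := hbound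
    _ ≤ 2 * (C * D ^ 2 * (1 + 2 * B) * x ^ (1 - ε / 2)) + D * G * x ^ (1 - ε / 2) := by linarith
    _ = _ := by ring
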